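/- Let $A$ be a ring that is étale over a polynomial ring $\mathbb Z[x_1,\dots,x_r]$ (for some $r\ge 0$), let $S=\operatorname{Spec}A$, and let $f:X\to S$ be a smooth projective morphism. All sheaves are sheaves for the Zariski topology. Write $\Omega^\bullet=\Omega^\bullet_{X/S}$ for the relative De Rham complex and $H^m_{DR}(X/S)=\mathbb H^m(X,\Omega^\bullet)$. Assume that all De Rham cohomology groups $H^m_{DR}(X/S)$ and all Hodge cohomology groups $H^j(X,\Omega^i)$ are free $A$-modules. For a positive integer $N$ put $Z_N\Omega^i=\{\omega\in\Omega^i\mid d\omega\in N\,\Omega^{i+1}\}$, and write $M/N$ for $M/NM$. For a complex of sheaves $\mathcal C^\bullet$ let $\mathcal C^{\bullet\ge i}$ be the subcomplex that is $0$ in degrees $<i$ and $\mathcal C^j$ in degrees $j\ge i$, and let $t_{\le i}\mathcal C^\bullet$ be the subcomplex that is $\mathcal C^j$ in degrees $j<i$, $\ker(d:\mathcal C^i\to\mathcal C^{i+1})$ in degree $i$, and $0$ in degrees $>i$. Put $$\mathrm{Fil}^i_{\mathrm{Hodge}}\mathbb H^m(X,\mathcal C^\bullet)=\operatorname{im}\bigl(\mathbb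 H^m(X,\mathcal C^{\bullet\ge i})\to\mathbb H^m(X,\mathcal C^\bullet)\bigr),\qquad \mathrm{Fil}^{\mathrm{con}}_i\mathbb H^m(X,\mathcal C^\bullet)=\operatorname{im}\bigl(\mathbb H^m(X,t_{\le i}\mathcal C^\bullet)\to\mathbb H^m(X,\mathcal C^\bullet)\bigr).$$ Fix a positive integer $N$ and assume that $H^j(X,Z_N\Omega^i)\to H^j(X,\Omega^i)$ is an isomorphism for all $i,j$. Then for every $m\ge 0$ the following holds. 1. The canonical maps $H^m_{DR}(X/S)/N\to\mathbb H^m(X,\Omega^\bullet/N)$ and $H^{m-i}(X,\Omega^i)/N\to H^{m-i}(X,\Omega^i/N)$ are isomorphisms for all $i$. For all $i$ the Hodge filtration $\mathrm{Fil}^i_{\mathrm{Hodge}}\mathbb H^m(X,\Omega^\bullet/N)$ is the image of $\mathrm{Fil}^i_{\mathrm{Hodge}}H^m_{DR}(X/S)$, and the map $\mathrm{Fil}^i_{\mathrm{Hodge}}H^m_{DR}(X/S)/N\to H^m_{DR}(X/S)/N$ is injective. So we may write $\mathrm{Fil}^i_{\mathrm{Hodge}}H^m_{DR}(X/S)/N$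 for this submodule of $H^m_{DR}(X/S)/N=\mathbb H^m(X,\Omega^\bullet/N)$. 2. For all $i$ the conjugate filtration is opposite to the Hodge filtration: $$H^m_{DR}(X/S)/N=\mathrm{Fil}^{\mathrm{con}}_i\mathbb H^m(X,\Omega^\bullet/N)\oplus\mathrm{Fil}^{i+1}_{\mathrm{Hodge}}H^m_{DR}(X/S)/N.$$ 3. For all $i$ there is an isomorphism of $A$-modules $$\mathrm{Fil}^{\mathrm{con}}_i\mathbb H^m(X,\Omega^\bullet/N)\cap\mathrm{Fil}^i_{\mathrm{Hodge}}H^m_{DR}(X/S)/N\;\cong\;H^{m-i}(X,\Omega^i)/N,$$ namely the one induced by $\mathbb H^m(X,(\Omega^\bullet/N)^{\bullet\ge i})\to H^{m-i}(X,\Omega^i/N)$. 4. Combining the inverses of the isomorphisms in 3 gives the Hodge decomposition $$H^m_{DR}(X/S)/N\;\cong\;\bigoplus_{i=0}^m H^{m-i}(X,\Omega^i)/N.$$ -/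

import Mathlib

open CategoryTheory Limits AlgebraicGeometry ZeroObject
universe u w v t
namespace DeRhamMod

section Exterior
variable (A : Type*) (B : Type*) [CommRing A] [CommRing B] [Algebra A B]

/-- The exterior algebra `⨁ₙ Ωⁿ` of the module of Kaehler differentials of `B` over `A`. -/
abbrev FormAlg : Type _ := ExteriorAlgebra B (Ω[B⁄A])

/-- The differential `db`, as an element of degree one of the exterior algebra. -/
noncomputable abbrev dB (b : B) : FormAlg A B := ExteriorAlgebra.ι B (KaehlerDifferential.D A B b)

/-- The grade involution: multiplication by `(-1)ⁿ` in degree `n`. -/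
noncomputable abbrev sgn : FormAlg A B →ₐ[B] FormAlg A B := CliffordAlgebra.involute

/-- Auxiliary ring used to construct the exterior derivative: pairs of forms with the product
`(x, x') (y, y') = (x y, x' y + sgn(x) y')`, so that `x ↦ (x, dx)` is a ring homomorphism. -/
structure TwForm where
  fst : FormAlg A B
  snd : FormAlg A B

variable {A B}
namespace TwForm
@[ext] theorem ext' {x y : TwForm A B} (h : x.fst = y.fst) (h' : x.snd = y.snd) : x = y := by
  cases x; cases y; simp_all
noncomputable instance : Zero (TwForm A B) := ⟨⟨0, 0⟩⟩
noncomputable instance : One (TwForm A B) := ⟨⟨1, 0⟩⟩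
noncomputable instance : Add (TwForm A B) := ⟨fun x y => ⟨x.fst + y.fst, x.snd + y.snd⟩⟩
noncomputable instance : Neg (TwForm A B) := ⟨fun x => ⟨-x.fst, -x.snd⟩⟩
noncomputable instance : Mul (TwForm A B) := ⟨fun x y => ⟨x.fst * y.fst, x.snd * y.fst + sgn A B x.fst * y.snd⟩⟩
theorem fst_zero : (0 : TwForm A B).fst = 0 := rfl
theorem snd_zero : (0 : TwForm A B).snd = 0 := rfl
theorem fst_one : (1 : TwForm A B).fst = 1 := rfl
theorem snd_one : (1 : TwForm A B).snd = 0 := rfl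
theorem fst_add (x y : TwForm A B) : (x + y).fst = x.fst + y.fst := rfl
theorem snd_add (x y : TwForm A B) : (x + y).snd = x.snd + y.snd := rfl
theorem fst_neg (x : TwForm A B) : (-x).fst = -x.fst := rfl
theorem snd_neg (x : TwForm A B) : (-x).snd = -x.snd := rfl
theorem fst_mul (x y : TwForm A B) : (x * y).fst = x.fst * y.fst := rfl
theorem snd_mul (x y : TwForm A B) : (x * y).snd = x.snd * y.fst + sgn A B x.fst * y.snd := rfl

noncomputable instance : Ring (TwForm A B) where
  add_assoc x y z := by ext <;> simp [fst_add, snd_add, add_assoc]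
  zero_add x := by ext <;> simp [fst_add, snd_add, fst_zero, snd_zero]
  add_zero x := by ext <;> simp [fst_add, snd_add, fst_zero, snd_zero]
  add_comm x y := by ext <;> simp [fst_add, snd_add, add_comm]
  neg_add_cancel x := by ext <;> simp [fst_add, snd_add, fst_zero, snd_zero, fst_neg, snd_neg]
  nsmul := nsmulRec
  zsmul := zsmulRec
  mul_assoc x y z := by
    ext <;> simp only [fst_mul, snd_mul, map_mul, mul_assoc, add_mul, mul_add, add_assoc]
  one_mul x := by ext <;> simp [fst_mul, snd_mul, fst_one, snd_one]
  mul_one x := by ext <;> simp [fst_mul, snd_mul, fst_one, snd_one]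
  left_distrib x y z := by
    ext <;> simp only [fst_mul, snd_mul, fst_add, snd_add, mul_add]; abel
  right_distrib x y z := by
    ext <;> simp only [fst_mul, snd_mul, fst_add, snd_add, map_add, add_mul]; abel
  zero_mul x := by ext <;> simp [fst_mul, snd_mul, fst_zero, snd_zero]
  mul_zero x := by ext <;> simp [fst_mul, snd_mul, fst_zero, snd_zero]
end TwForm

theorem sgn_ι (ω : Ω[B⁄A]) : sgn A B (ExteriorAlgebra.ι B ω) = -ExteriorAlgebra.ι B ω :=
  CliffordAlgebra.involute_ι ω

theorem ι_mul_ι (ω η : Ω[B⁄A]) : ExteriorAlgebra.ι B ω * ExteriorAlgebra.ι B η =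
    -(ExteriorAlgebra.ι B η * ExteriorAlgebra.ι B ω) :=
  eq_neg_of_add_eq_zero_left (ExteriorAlgebra.ι_add_mul_swap ω η)

theorem ι_mul_eq (ω : Ω[B⁄A]) (x : FormAlg A B) :
    ExteriorAlgebra.ι B ω * x = sgn A B x * ExteriorAlgebra.ι B ω := by
  induction x using ExteriorAlgebra.induction with
  | algebraMap r => rw [AlgHom.commutes]; exact (Algebra.commutes r _).symm
  | ι η => rw [sgn_ι, neg_mul]; exact ι_mul_ι ω η
  | mul a b ha hb => rw [map_mul, ← mul_assoc, ha, mul_assoc, hb, mul_assoc]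
  | add a b ha hb => rw [map_add, mul_add, ha, hb, add_mul]

/-- The ring homomorphism `b ↦ (b, db)`. -/
noncomputable def twMap : B →+* TwForm A B where
  toFun b := ⟨algebraMap B _ b, dB A B b⟩
  map_one' := by ext <;> simp [TwForm.fst_one, TwForm.snd_one, dB]
  map_zero' := by ext <;> simp [TwForm.fst_zero, TwForm.snd_zero, dB]
  map_add' b c := by ext <;> simp [TwForm.fst_add, TwForm.snd_add, dB]
  map_mul' b c := by
    ext
    · simp [TwForm.fst_mul]
    · simp only [TwForm.snd_mul, dB, Derivation.leibniz, map_add, map_smul, AlgHom.commutes]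
      rw [← Algebra.commutes, ← Algebra.smul_def, ← Algebra.smul_def, add_comm]

noncomputable instance : Algebra B (TwForm A B) := twMap.toAlgebra' fun b x => by
  ext
  · exact Algebra.commutes _ _
  · change dB A B b * x.fst + sgn A B (algebraMap _ _ b) * x.snd =
      x.snd * algebraMap _ _ b + sgn A B x.fst * dB A B b
    rw [AlgHom.commutes, ι_mul_eq, ← Algebra.commutes, add_comm]

theorem tw_smul (b : B) (x : TwForm A B) : b • x = ⟨b • x.fst, dB A B b * x.fst + b • x.snd⟩ := by
  rw [Algebra.smul_def]
  ext
  · exact (Algebra.smul_def _ _).symm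
  · change dB A B b * x.fst + sgn A B (algebraMap _ _ b) * x.snd = _
    rw [AlgHom.commutes, ← Algebra.smul_def]

noncomputable instance : Algebra A (TwForm A B) := Algebra.compHom _ (algebraMap A B)
instance : IsScalarTower A B (TwForm A B) := IsScalarTower.of_algebraMap_eq' rfl

/-- The derivation `b ↦ (db, 0)`. -/
noncomputable def twDer : Derivation A B (TwForm A B) where
  toFun b := ⟨dB A B b, 0⟩
  map_add' b c := by ext <;> simp [TwForm.fst_add, TwForm.snd_add, dB]
  map_smul' a b := by
    rw [RingHom.id_apply, ← algebraMap_smul B a (_ : TwForm A B), tw_smul]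
    ext <;> simp [dB]
  map_one_eq_zero' := by ext <;> simp [TwForm.fst_zero, TwForm.snd_zero, dB]
  leibniz' b c := by
    change (⟨_, _⟩ : TwForm A B) = _
    rw [tw_smul, tw_smul]
    ext
    · simp [TwForm.fst_add, dB]
    · simp only [TwForm.snd_add]
      change 0 = dB A B b * dB A B c + b • (0 : FormAlg A B) + (dB A B c * dB A B b + c • (0 : FormAlg A B))
      rw [smul_zero, smul_zero, add_zero, add_zero]
      exact (ExteriorAlgebra.ι_add_mul_swap _ _).symm

/-- The map on one-forms `b dc ↦ (b dc, db ∧ dc)`. -/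
noncomputable def twι : Ω[B⁄A] →ₗ[B] TwForm A B := twDer.liftKaehlerDifferential

theorem twι_D (b : B) : twι (KaehlerDifferential.D A B b) = ⟨dB A B b, 0⟩ :=
  twDer.liftKaehlerDifferential_comp_D b

theorem kaehler_induction {P : Ω[B⁄A] → Prop} (h0 : P 0)
    (h : ∀ b c : B, P (b • KaehlerDifferential.D A B c))
    (hadd : ∀ x y, P x → P y → P (x + y)) (ω : Ω[B⁄A]) : P ω := by
  have hω : ω ∈ Submodule.span B (Set.range (KaehlerDifferential.D A B)) := by
    rw [KaehlerDifferential.span_range_derivation]; trivial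
  refine Submodule.closure_induction (p := fun x _ => P x) h0
    (fun x y _ _ hx hy => hadd x y hx hy) ?_ hω
  rintro r _ ⟨c, rfl⟩
  exact h r c

theorem twι_smul_D (b c : B) :
    twι (b • KaehlerDifferential.D A B c) = ⟨b • dB A B c, dB A B b * dB A B c⟩ := by
  rw [map_smul, twι_D, tw_smul, smul_zero, add_zero]

theorem twι_fst (ω : Ω[B⁄A]) : (twι ω).fst = ExteriorAlgebra.ι B ω := by
  induction ω using kaehler_induction with
  | h0 => simp [TwForm.fst_zero]
  | h b c => rw [twι_smul_D, map_smul]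
  | hadd x y hx hy => rw [map_add, map_add, TwForm.fst_add, hx, hy]

theorem twι_snd_comm (ω η : Ω[B⁄A]) :
    (twι ω).snd * ExteriorAlgebra.ι B η = ExteriorAlgebra.ι B η * (twι ω).snd := by
  induction ω using kaehler_induction with
  | h0 => simp [TwForm.snd_zero]
  | h b c => rw [twι_smul_D, ι_mul_eq η, map_mul, sgn_ι, sgn_ι, neg_mul_neg]
  | hadd x y hx hy => rw [map_add, TwForm.snd_add, add_mul, mul_add, hx, hy]

theorem twι_sq (ω : Ω[B⁄A]) : twι ω * twι ω = 0 := by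
  ext
  · rw [TwForm.fst_mul, twι_fst, ExteriorAlgebra.ι_sq_zero, TwForm.fst_zero]
  · rw [TwForm.snd_mul, twι_fst, sgn_ι, twι_snd_comm, neg_mul, add_neg_cancel, TwForm.snd_zero]

/-- The ring homomorphism `x ↦ (x, dx)` on the exterior algebra. -/
noncomputable def twLift : FormAlg A B →ₐ[B] TwForm A B := ExteriorAlgebra.lift B ⟨twι, twι_sq⟩

theorem twLift_ι (ω : Ω[B⁄A]) : twLift (ExteriorAlgebra.ι B ω) = twι ω :=
  ExteriorAlgebra.lift_ι_apply B twι twι_sq ω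

theorem twLift_fst (x : FormAlg A B) : (twLift x).fst = x := by
  induction x using ExteriorAlgebra.induction with
  | algebraMap r => rw [AlgHom.commutes]; rfl
  | ι η => rw [twLift_ι, twι_fst]
  | mul a b ha hb => rw [map_mul, TwForm.fst_mul, ha, hb]
  | add a b ha hb => rw [map_add, TwForm.fst_add, ha, hb]

variable (A B) in
/-- The exterior derivative on the exterior algebra of the Kaehler differentials. -/
noncomputable def extD : FormAlg A B →ₗ[A] FormAlg A B where
  toFun x := (twLift x).snd
  map_add' x y := by rw [map_add, TwForm.snd_add]
  map_smul' a x := by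
    rw [RingHom.id_apply, ← algebraMap_smul B a x, map_smul, tw_smul]
    simp [dB]

theorem extD_algebraMap (b : B) : extD A B (algebraMap B _ b) = dB A B b := by
  change (twLift _).snd = _
  rw [AlgHom.commutes]; rfl

theorem extD_smul_D (b c : B) : extD A B (ExteriorAlgebra.ι B (b • KaehlerDifferential.D A B c)) =
    dB A B b * dB A B c := by
  change (twLift _).snd = _
  rw [twLift_ι, twι_smul_D]

theorem extD_dB (b : B) : extD A B (dB A B b) = 0 := by
  change (twLift _).snd = _
  rw [twLift_ι, twι_D]

theorem extD_mul (x y : FormAlg A B) :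
    extD A B (x * y) = extD A B x * y + sgn A B x * extD A B y := by
  change (twLift _).snd = (twLift _).snd * y + _ * (twLift _).snd
  rw [map_mul, TwForm.snd_mul, twLift_fst, twLift_fst]

theorem sgn_extD (x : FormAlg A B) : sgn A B (extD A B x) = -extD A B (sgn A B x) := by
  induction x using ExteriorAlgebra.induction with
  | algebraMap r => rw [AlgHom.commutes, extD_algebraMap, sgn_ι]
  | ι η =>
    rw [sgn_ι, map_neg, neg_neg]
    induction η using kaehler_induction with
    | h0 => simp
    | h b c => rw [extD_smul_D, map_mul, sgn_ι, sgn_ι, neg_mul_neg]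
    | hadd x y hx hy => simp only [map_add, hx, hy]
  | mul a b ha hb =>
    rw [extD_mul, map_mul, map_add, map_mul, map_mul, extD_mul, ha, hb]
    simp only [neg_mul, mul_neg, neg_add]
  | add a b ha hb => simp only [map_add, ha, hb, neg_add]

theorem extD_extD (x : FormAlg A B) : extD A B (extD A B x) = 0 := by
  induction x using ExteriorAlgebra.induction with
  | algebraMap r => rw [extD_algebraMap, extD_dB]
  | ι η =>
    induction η using kaehler_induction with
    | h0 => simp
    | h b c => rw [extD_smul_D, extD_mul, extD_dB, extD_dB, zero_mul, mul_zero, add_zero]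
    | hadd x y hx hy => simp only [map_add, hx, hy, add_zero]
  | mul a b ha hb =>
    rw [extD_mul, map_add, extD_mul, extD_mul, ha, hb, sgn_extD]
    simp
  | add a b ha hb => simp only [map_add, ha, hb, add_zero]

theorem extD_mem (n : ℕ) (x : FormAlg A B) (hx : x ∈ ⋀[B]^n (Ω[B⁄A])) :
    extD A B x ∈ ⋀[B]^(n + 1) (Ω[B⁄A]) := by
  have h1 : ∀ η : Ω[B⁄A], ExteriorAlgebra.ι B η ∈ ⋀[B]^1 (Ω[B⁄A]) := fun η => by
    change _ ∈ LinearMap.range _ ^ 1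
    rw [pow_one]; exact ⟨η, rfl⟩
  induction hx using Submodule.pow_induction_on_left' with
  | algebraMap r => rw [extD_algebraMap, zero_add]; exact h1 _
  | add x y i _ _ hx hy => rw [map_add]; exact add_mem hx hy
  | mem_mul m hm i x hx ih =>
    obtain ⟨η, rfl⟩ := hm
    rw [extD_mul, sgn_ι, neg_mul]
    refine add_mem ?_ (neg_mem ?_)
    · rw [show i.succ + 1 = 2 + i by omega]
      refine SetLike.mul_mem_graded (A := fun i : ℕ => ⋀[B]^i (Ω[B⁄A])) ?_ hx
      induction η using kaehler_induction with
      | h0 => simp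
      | h b c =>
        rw [extD_smul_D]
        exact SetLike.mul_mem_graded (A := fun i : ℕ => ⋀[B]^i (Ω[B⁄A])) (i := 1) (j := 1)
          (h1 _) (h1 _)
      | hadd x y hx hy => rw [map_add, map_add]; exact add_mem hx hy
    · rw [show i.succ + 1 = 1 + (i + 1) by omega]
      exact SetLike.mul_mem_graded (A := fun i : ℕ => ⋀[B]^i (Ω[B⁄A])) (h1 _) ih

variable (A B) in
/-- The exterior derivative `d : Ωⁿ → Ωⁿ⁺¹` of the algebra `B` over `A`. -/
noncomputable def deRhamD (n : ℕ) : ⋀[B]^n (Ω[B⁄A]) →ₗ[A] ⋀[B]^(n + 1) (Ω[B⁄A]) where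
  toFun x := ⟨extD A B x.1, extD_mem (A := A) (B := B) n x.1 x.2⟩
  map_add' x y := by ext; simp
  map_smul' a x := by ext; exact map_smul (extD A B) a x.1

theorem deRhamD_deRhamD (n : ℕ) (x : ⋀[B]^n (Ω[B⁄A])) :
    deRhamD A B (n + 1) (deRhamD A B n x) = 0 := Subtype.ext (extD_extD x.1)

variable {B' : Type*} [CommRing B'] [Algebra A B']

/-- The map on exterior algebras of differentials induced by a map of `A`-algebras,
`b dc ↦ f(b) df(c)`. -/
noncomputable def kMap (f : B →ₐ[A] B') : FormAlg A B →ₐ[A] FormAlg A B' :=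
  letI : Algebra B B' := f.toRingHom.toAlgebra
  haveI : IsScalarTower A B B' := IsScalarTower.of_algHom f
  (ExteriorAlgebra.lift B
    ⟨((ExteriorAlgebra.ι B').restrictScalars B).comp (KaehlerDifferential.map A A B B'),
      fun _ => ExteriorAlgebra.ι_sq_zero _⟩).restrictScalars A

theorem kMap_algebraMap (f : B →ₐ[A] B') (b : B) :
    kMap f (algebraMap B _ b) = algebraMap B' _ (f b) := by
  let _ : Algebra B B' := f.toRingHom.toAlgebra
  have : IsScalarTower A B B' := IsScalarTower.of_algHom f
  exact (AlgHom.commutes (ExteriorAlgebra.lift B _) b).trans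
    (IsScalarTower.algebraMap_apply B B' (FormAlg A B') b)

theorem kMap_smul_D (f : B →ₐ[A] B') (b c : B) :
    kMap f (ExteriorAlgebra.ι B (b • KaehlerDifferential.D A B c)) =
      ExteriorAlgebra.ι B' (f b • KaehlerDifferential.D A B' (f c)) := by
  let _ : Algebra B B' := f.toRingHom.toAlgebra
  have : IsScalarTower A B B' := IsScalarTower.of_algHom f
  refine (ExteriorAlgebra.lift_ι_apply B _ _ _).trans ?_
  change ExteriorAlgebra.ι B' (KaehlerDifferential.map A A B B' _) = _
  rw [map_smul, KaehlerDifferential.map_D, ← algebraMap_smul B' b]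
  rfl

theorem kMap_ι (f : B →ₐ[A] B') (ω : Ω[B⁄A]) :
    ∃ η, kMap f (ExteriorAlgebra.ι B ω) = ExteriorAlgebra.ι B' η := by
  let _ : Algebra B B' := f.toRingHom.toAlgebra
  have : IsScalarTower A B B' := IsScalarTower.of_algHom f
  exact ⟨KaehlerDifferential.map A A B B' ω, ExteriorAlgebra.lift_ι_apply B _ _ _⟩

/-- Induction on forms: the exterior algebra is generated by the functions and the `b dc`. -/
theorem ext_induction {P : FormAlg A B → Prop} (hb : ∀ b : B, P (algebraMap B _ b))
    (h : ∀ b c : B, P (ExteriorAlgebra.ι B (b • KaehlerDifferential.D A B c)))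
    (hadd : ∀ x y, P x → P y → P (x + y)) (hmul : ∀ x y, P x → P y → P (x * y))
    (x : FormAlg A B) : P x := by
  induction x using ExteriorAlgebra.induction with
  | algebraMap r => exact hb r
  | ι η =>
    induction η using kaehler_induction with
    | h0 => simpa using hb 0
    | h b c => exact h b c
    | hadd x y hx hy => rw [map_add]; exact hadd _ _ hx hy
  | mul a b ha hb => exact hmul a b ha hb
  | add a b ha hb => exact hadd a b ha hb

theorem kMap_sgn (f : B →ₐ[A] B') (x : FormAlg A B) : kMap f (sgn A B x) = sgn A B' (kMap f x) := by
  induction x using ext_induction with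
  | hb b => rw [AlgHom.commutes, kMap_algebraMap, AlgHom.commutes]
  | h b c => rw [sgn_ι, map_neg, kMap_smul_D, sgn_ι]
  | hadd x y hx hy => simp only [map_add, hx, hy]
  | hmul x y hx hy => simp only [map_mul, hx, hy]

theorem kMap_extD (f : B →ₐ[A] B') (x : FormAlg A B) :
    kMap f (extD A B x) = extD A B' (kMap f x) := by
  have h1 : ∀ c : B, kMap f (dB A B c) = dB A B' (f c) := fun c => by
    simpa using kMap_smul_D f 1 c
  induction x using ext_induction with
  | hb b => rw [extD_algebraMap, kMap_algebraMap, extD_algebraMap, h1]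
  | h b c => rw [extD_smul_D, kMap_smul_D, extD_smul_D, map_mul, h1, h1]
  | hadd x y hx hy => simp only [map_add, hx, hy]
  | hmul x y hx hy => rw [extD_mul, map_add, map_mul, map_mul, map_mul, extD_mul, hx, hy, kMap_sgn]

theorem kMap_id (x : FormAlg A B) : kMap (AlgHom.id A B) x = x := by
  induction x using ext_induction with
  | hb b => rw [kMap_algebraMap]; rfl
  | h b c => rw [kMap_smul_D]; rfl
  | hadd x y hx hy => simp only [map_add, hx, hy]
  | hmul x y hx hy => simp only [map_mul, hx, hy]

theorem kMap_comp {B'' : Type*} [CommRing B''] [Algebra A B''] (f : B →ₐ[A] B') (g : B' →ₐ[A] B'')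
    (x : FormAlg A B) : kMap (g.comp f) x = kMap g (kMap f x) := by
  induction x using ext_induction with
  | hb b => simp only [kMap_algebraMap]; rfl
  | h b c => simp only [kMap_smul_D]; rfl
  | hadd x y hx hy => simp only [map_add, hx, hy]
  | hmul x y hx hy => simp only [map_mul, hx, hy]

theorem kMap_mem (f : B →ₐ[A] B') (n : ℕ) (x : FormAlg A B) (hx : x ∈ ⋀[B]^n (Ω[B⁄A])) :
    kMap f x ∈ ⋀[B']^n (Ω[B'⁄A]) := by
  induction hx using Submodule.pow_induction_on_left' with
  | algebraMap r => rw [kMap_algebraMap]; exact SetLike.algebraMap_mem_graded (fun i : ℕ => ⋀[B']^i (Ω[B'⁄A])) _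
  | add x y i _ _ hx hy => rw [map_add]; exact add_mem hx hy
  | mem_mul m hm i x hx ih =>
    obtain ⟨η, rfl⟩ := hm
    obtain ⟨η', h'⟩ := kMap_ι f η
    rw [map_mul, h']
    change _ ∈ LinearMap.range _ ^ (i + 1)
    rw [pow_succ']
    exact Submodule.mul_mem_mul ⟨η', rfl⟩ ih

/-- The map `Ωⁿ_{B/A} → Ωⁿ_{B'/A}` induced by a map of `A`-algebras `B → B'`. -/
noncomputable def formsMap (f : B →ₐ[A] B') (n : ℕ) :
    ⋀[B]^n (Ω[B⁄A]) →ₗ[A] ⋀[B']^n (Ω[B'⁄A]) where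
  toFun x := ⟨kMap f x.1, kMap_mem f n x.1 x.2⟩
  map_add' x y := by ext; simp
  map_smul' a x := by ext; exact map_smul (kMap f) a x.1

theorem formsMap_deRhamD (f : B →ₐ[A] B') (n : ℕ) (x : ⋀[B]^n (Ω[B⁄A])) :
    formsMap f (n + 1) (deRhamD A B n x) = deRhamD A B' n (formsMap f n x) :=
  Subtype.ext (kMap_extD f x.1)

end Exterior

section Functors
variable (A : Type u) [CommRing A]

/-- The functor `B ↦ Ωⁿ_{B/A} = ⋀ⁿ_B Ω_{B/A}` from commutative `A`-algebras to `A`-modules. -/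
noncomputable def formsFunctor (n : ℕ) : CommAlgCat.{u} A ⥤ ModuleCat.{u} A where
  obj B := ModuleCat.of A (⋀[B]^n (Ω[B⁄A]))
  map f := ModuleCat.ofHom (formsMap f.hom n)
  map_id B := by
    exact ModuleCat.hom_ext (LinearMap.ext fun x => Subtype.ext (kMap_id x.1))
  map_comp f g := by
    exact ModuleCat.hom_ext (LinearMap.ext fun x => Subtype.ext (kMap_comp f.hom g.hom x.1))

/-- The exterior derivative as a natural transformation. -/
noncomputable def formsD (n : ℕ) : formsFunctor A n ⟶ formsFunctor A (n + 1) where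
  app B := ModuleCat.ofHom (deRhamD A B n)
  naturality B C f := by
    ext x
    exact (formsMap_deRhamD f.hom n x).symm

theorem formsD_comp (n : ℕ) : formsD A n ≫ formsD A (n + 1) = 0 := by
  ext B x
  exact deRhamD_deRhamD n x

end Functors

section
variable {𝒜 : Type u} [Category.{v} 𝒜] [Abelian 𝒜]

/-- The subcomplex `K^{• ≥ i}` (zero in degrees `< i`, equal to `K` in degrees `≥ i`). -/
noncomputable abbrev stupidGE (K : CochainComplex 𝒜 ℤ) (i : ℤ) : CochainComplex 𝒜 ℤ :=
  HomologicalComplex.stupidTrunc K (ComplexShape.embeddingUpIntGE i)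

theorem embGE_f {i j : ℤ} (h : i ≤ j) :
    (ComplexShape.embeddingUpIntGE i).f (j - i).toNat = j := by
  simp; omega

/-- In degrees `j ≥ i` the complex `K^{• ≥ i}` agrees with `K`. -/
noncomputable def stupidGEXIso (K : CochainComplex 𝒜 ℤ) {i j : ℤ} (h : i ≤ j) :
    (stupidGE K i).X j ≅ K.X j :=
  HomologicalComplex.stupidTruncXIso K (ComplexShape.embeddingUpIntGE i) (embGE_f h)

theorem stupidTrunc_d_comp {ι ι' : Type*} {c : ComplexShape ι} {c' : ComplexShape ι'}
    (K : HomologicalComplex 𝒜 c') (e : c.Embedding c') [e.IsRelIff] {i j : ι} {i' j' : ι'}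
    (hi : e.f i = i') (hj : e.f j = j') :
    (K.stupidTrunc e).d i' j' ≫ (K.stupidTruncXIso e hj).hom =
      (K.stupidTruncXIso e hi).hom ≫ K.d i' j' := by
  subst hi hj
  have h1 : ∀ k, (K.stupidTruncXIso e (rfl : e.f k = e.f k)).hom =
      ((K.restriction e).extendXIso e (rfl : e.f k = e.f k)).hom := fun k => Category.comp_id _
  rw [h1, h1]
  refine (congrArg (· ≫ _) ((K.restriction e).extend_d_eq e rfl rfl)).trans ?_
  refine (Category.assoc _ _ _).trans (congrArg (_ ≫ ·) ?_)
  exact (Category.assoc _ _ _).trans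
    ((congrArg (_ ≫ ·) (Iso.inv_hom_id _)).trans (Category.comp_id _))

theorem isZero_stupidGE_X (K : CochainComplex 𝒜 ℤ) {i j : ℤ} (h : j < i) :
    IsZero ((stupidGE K i).X j) :=
  HomologicalComplex.isZero_stupidTrunc_X _ _ _ (fun k => by simp; omega)

/-- The inclusion of complexes `K^{• ≥ i} ⟶ K`. -/
noncomputable def stupidGEι (K : CochainComplex 𝒜 ℤ) (i : ℤ) : stupidGE K i ⟶ K where
  f j := if h : i ≤ j then (stupidGEXIso K h).hom else 0
  comm' j k hjk := by
    by_cases hj : i ≤ j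
    · have hk : i ≤ k := by have : j + 1 = k := hjk; omega
      rw [dif_pos hj, dif_pos hk]
      exact (stupidTrunc_d_comp K _ _ _).symm
    · exact (isZero_stupidGE_X K (not_le.1 hj)).eq_of_src _ _

/-- The projection `K^{• ≥ i} ⟶ K^i[-i]` onto the term of lowest degree. -/
noncomputable def stupidGEToSingle (K : CochainComplex 𝒜 ℤ) (i : ℤ) :
    stupidGE K i ⟶ (CochainComplex.singleFunctor 𝒜 i).obj (K.X i) :=
  HomologicalComplex.mkHomToSingle (stupidGEXIso K le_rfl).hom fun j hj =>
    (isZero_stupidGE_X K (by have : j + 1 = i := hj; omega)).eq_of_src _ _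

/-- The complex `K / N K`. -/
noncomputable abbrev cplxMod (K : CochainComplex 𝒜 ℤ) (N : ℕ) : CochainComplex 𝒜 ℤ :=
  cokernel (N • 𝟙 K)
/-- The projection `K ⟶ K / N K`. -/
noncomputable abbrev cplxModπ (K : CochainComplex 𝒜 ℤ) (N : ℕ) : K ⟶ cplxMod K N :=
  cokernel.π (N • 𝟙 K)

/-- The object `Z_N K^i = {ω ∈ K^i | dω ∈ N K^{i+1}}`. -/
noncomputable abbrev closedMod (K : CochainComplex 𝒜 ℤ) (N : ℕ) (i : ℤ) : 𝒜 :=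
  kernel (K.d i (i + 1) ≫ cokernel.π (N • 𝟙 (K.X (i + 1))))
/-- The inclusion `Z_N K^i ⟶ K^i`. -/
noncomputable abbrev closedModι (K : CochainComplex 𝒜 ℤ) (N : ℕ) (i : ℤ) : closedMod K N i ⟶ K.X i :=
  kernel.ι _

theorem nsmul_cplxModπ (K : CochainComplex 𝒜 ℤ) (N : ℕ) : N • cplxModπ K N = 0 := by
  rw [← Category.id_comp (cplxModπ K N), ← Preadditive.nsmul_comp]
  exact cokernel.condition _

theorem nsmul_single (K : CochainComplex 𝒜 ℤ) (N : ℕ) (i : ℤ) :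
    N • (CochainComplex.singleFunctor 𝒜 0).map ((cplxModπ K N).f i) = 0 := by
  rw [← Functor.map_nsmul, ← HomologicalComplex.nsmul_f_apply, nsmul_cplxModπ]
  simp

variable [HasDerivedCategory.{w} 𝒜] (R : Type t) [CommRing R] [Linear R 𝒜] (I : 𝒜)

/-- Hypercohomology `ℍ^m(K) = Hom_D(I, K[m])` in the derived category, relative to an object `I`.
When `I` is the constant sheaf with value `A` in the category of sheaves of `A`-modules, the
functor `Hom(I, -)` is the global sections functor, and this is the usual hypercohomology. -/
noncomputable def HyperH (K : CochainComplex 𝒜 ℤ) (m : ℤ) : ModuleCat.{w} R :=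
  ModuleCat.of R ((DerivedCategory.singleFunctor 𝒜 0).obj I ⟶
    (shiftFunctor (DerivedCategory 𝒜) m).obj (DerivedCategory.Q.obj K))

/-- Cohomology `H^j(F)`: the hypercohomology of the complex with `F` in degree `0`. -/
noncomputable abbrev SheafH (F : 𝒜) (j : ℤ) : ModuleCat.{w} R :=
  HyperH R I ((CochainComplex.singleFunctor 𝒜 0).obj F) j

/-- The quotient `M / N M`. -/
abbrev ModBy (M : Type*) [AddCommGroup M] [Module R M] (N : ℕ) : Type _ :=
  M ⧸ LinearMap.range (LinearMap.lsmul R M (N : R))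

/-- The map `ℍ^m(K) → ℍ^m(L)` induced by a morphism of complexes. -/
noncomputable def hyperHMap {K L : CochainComplex 𝒜 ℤ} (φ : K ⟶ L) (m : ℤ) :
    HyperH R I K m →ₗ[R] HyperH R I L m :=
  Linear.rightComp R ((DerivedCategory.singleFunctor 𝒜 0).obj I)
    ((shiftFunctor (DerivedCategory 𝒜) m).map (DerivedCategory.Q.map φ))

/-- The map `H^j(F) → H^j(G)` induced by a morphism. -/
noncomputable def sheafHMap {F G : 𝒜} (φ : F ⟶ G) (j : ℤ) : SheafH R I F j →ₗ[R] SheafH R I G j :=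
  hyperHMap R I ((CochainComplex.singleFunctor 𝒜 0).map φ) j

theorem hyperHMap_smul_eq_zero {K L : CochainComplex 𝒜 ℤ} (φ : K ⟶ L) (N : ℕ) (hφ : N • φ = 0)
    (m : ℤ) (x : HyperH R I K m) : hyperHMap R I φ m ((N : R) • x) = 0 := by
  rw [map_smul, Nat.cast_smul_eq_nsmul]
  change N • ((show (DerivedCategory.singleFunctor 𝒜 0).obj I ⟶
    (shiftFunctor (DerivedCategory 𝒜) m).obj (DerivedCategory.Q.obj K) from x) ≫
    (shiftFunctor (DerivedCategory 𝒜) m).map (DerivedCategory.Q.map φ)) = 0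
  rw [← Preadditive.comp_nsmul, ← Functor.map_nsmul, ← Functor.map_nsmul, hφ, Functor.map_zero,
    Functor.map_zero]
  exact comp_zero

/-- If `N φ = 0`, the map `ℍ^m(K) / N ℍ^m(K) → ℍ^m(L)` induced by `φ`. -/
noncomputable def hyperHModMap {K L : CochainComplex 𝒜 ℤ} (φ : K ⟶ L) (N : ℕ) (hφ : N • φ = 0)
    (m : ℤ) : ModBy R (HyperH R I K m) N →ₗ[R] HyperH R I L m :=
  Submodule.liftQ _ (hyperHMap R I φ m) (by
    rintro _ ⟨x, rfl⟩
    exact hyperHMap_smul_eq_zero R I φ N hφ m x)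

/-- The identification `F[-i][m] ≅ F[m-i]` in the derived category. -/
noncomputable def shiftIso (F : 𝒜) (m i : ℤ) :
    (shiftFunctor (DerivedCategory 𝒜) m).obj
      (DerivedCategory.Q.obj ((CochainComplex.singleFunctor 𝒜 i).obj F)) ≅
    (shiftFunctor (DerivedCategory 𝒜) (m - i)).obj
      (DerivedCategory.Q.obj ((CochainComplex.singleFunctor 𝒜 0).obj F)) :=
  (shiftFunctorAdd' (DerivedCategory 𝒜) i (m - i) m (by omega)).app _ ≪≫
    (shiftFunctor _ (m - i)).mapIso
      (((DerivedCategory.singleFunctors 𝒜).shiftIso i 0 i (by omega)).app F)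

/-- The map `ℍ^m(K^{• ≥ i}) → ℍ^m(K^i[-i]) = H^{m-i}(K^i)`. -/
noncomputable def hodgeGr (K : CochainComplex 𝒜 ℤ) (i m : ℤ) :
    HyperH R I (stupidGE K i) m →ₗ[R] SheafH R I (K.X i) (m - i) :=
  (Linear.rightComp R ((DerivedCategory.singleFunctor 𝒜 0).obj I)
    (shiftIso (K.X i) m i).hom).comp (hyperHMap R I (stupidGEToSingle K i) m)

/-- `Fil_Hodge^i ℍ^m(K)`, the image of `ℍ^m(K^{• ≥ i})`. -/
noncomputable def filHodge (K : CochainComplex 𝒜 ℤ) (i m : ℤ) : Submodule R (HyperH R I K m) :=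
  LinearMap.range (hyperHMap R I (stupidGEι K i) m)

/-- `Fil^con_i ℍ^m(K)`, the image of `ℍ^m(t_{≤ i} K)`, where `t_{≤ i} K` is the canonical
truncation. -/
noncomputable def filCon (K : CochainComplex 𝒜 ℤ) (i m : ℤ) : Submodule R (HyperH R I K m) :=
  LinearMap.range (hyperHMap R I (K.ιTruncLE i) m)

end

section
variable {A : Type u} [CommRing A] (X : Scheme.{u})
variable (A) in
/-- The category of Zariski sheaves of `A`-modules on `X`. -/
def ShMod : Type (u + 1) := Sheaf (Opens.grothendieckTopology X) (ModuleCat.{u} A)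

noncomputable instance : Category.{u} (ShMod A X) :=
  inferInstanceAs (Category (Sheaf (Opens.grothendieckTopology X) (ModuleCat.{u} A)))

noncomputable instance : Abelian (ShMod A X) :=
  inferInstanceAs (Abelian (Sheaf (Opens.grothendieckTopology X) (ModuleCat.{u} A)))

noncomputable instance : Linear A (ShMod A X) :=
  inferInstanceAs (Linear A (Sheaf (Opens.grothendieckTopology X) (ModuleCat.{u} A)))

noncomputable instance : HasDerivedCategory.{u + 1} (ShMod A X) :=
  HasDerivedCategory.standard (ShMod A X)

variable (A) in
/-- The sheaf associated with a presheaf of `A`-modules on `X`. -/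
noncomputable def sheafification : (X.Opensᵒᵖ ⥤ ModuleCat.{u} A) ⥤ ShMod A X :=
  presheafToSheaf (Opens.grothendieckTopology X) (ModuleCat.{u} A)

instance : (sheafification A X).Additive :=
  inferInstanceAs (presheafToSheaf (Opens.grothendieckTopology X) (ModuleCat.{u} A)).Additive

variable (A) in
/-- The constant sheaf with value `A` on `X`. -/
noncomputable def unitSheaf : ShMod A X :=
  (constantSheaf (Opens.grothendieckTopology X) (ModuleCat.{u} A)).obj (ModuleCat.of A A)

attribute [local instance] MvPolynomial.gradedAlgebra

/-- Projective `n`-space over `A`, as `Proj` of the polynomial ring in `n + 1` variables. -/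
noncomputable def ProjSpace (A : Type u) [CommRing A] (n : ℕ) : Scheme.{u} :=
  Proj (MvPolynomial.homogeneousSubmodule (Fin (n + 1)) A)

/-- The structure morphism of projective space. -/
noncomputable def ProjSpace.toSpec (A : Type u) [CommRing A] (n : ℕ) : ProjSpace A n ⟶ Spec (.of A) :=
  Proj.toSpecZero (MvPolynomial.homogeneousSubmodule (Fin (n + 1)) A) ≫
    Spec.map (CommRingCat.ofHom (algebraMap A (MvPolynomial.homogeneousSubmodule (Fin (n + 1)) A 0)))
end

section
variable {A : Type u} [CommRing A] {X : Scheme.{u}} (f : X ⟶ Spec (CommRingCat.of A))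

/-- The structure map `A → Γ(X, U)` of a scheme over `Spec A`. -/
noncomputable def structMap (U : X.Opens) : A →+* Γ(X, U) :=
  (f.appLE ⊤ U le_top).hom.comp (Scheme.ΓSpecIso (CommRingCat.of A)).inv.hom

theorem map_structMap {U V : X.Opensᵒᵖ} (i : U ⟶ V) (a : A) :
    (X.presheaf.map i).hom (structMap f U.unop a) = structMap f V.unop a := by
  have h := f.appLE_map (U := ⊤) (V := U.unop) le_top i
  exact congrArg (fun g => g.hom ((Scheme.ΓSpecIso (CommRingCat.of A)).inv.hom a)) h

/-- The ring `Γ(X, U)` as an `A`-algebra. -/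
noncomputable def sectionsObj (U : X.Opens) : CommAlgCat.{u} A :=
  letI := (structMap f U).toAlgebra
  CommAlgCat.of A Γ(X, U)

/-- The restriction maps of the structure sheaf, as homomorphisms of `A`-algebras. -/
noncomputable def sectionsMap {U V : X.Opensᵒᵖ} (i : U ⟶ V) :
    sectionsObj f U.unop ⟶ sectionsObj f V.unop :=
  letI := (structMap f U.unop).toAlgebra
  letI := (structMap f V.unop).toAlgebra
  CommAlgCat.ofHom ⟨(X.presheaf.map i).hom, map_structMap f i⟩

/-- The structure sheaf of a scheme over `Spec A`, as a presheaf of `A`-algebras. -/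
noncomputable def sectionsAlg : X.Opensᵒᵖ ⥤ CommAlgCat.{u} A where
  obj U := sectionsObj f U.unop
  map i := sectionsMap f i
  map_id U := CommAlgCat.hom_ext (AlgHom.ext fun x =>
    congrArg (fun g => g.hom x) (X.presheaf.map_id U))
  map_comp i j := CommAlgCat.hom_ext (AlgHom.ext fun x =>
    congrArg (fun g => g.hom x) (X.presheaf.map_comp i j))

/-- The sheaf `Ω^i_{X/S}` for `S = Spec A`: the sheaf associated with `U ↦ ⋀^i Ω_{Γ(X, U)/A}`
(and zero for `i < 0`). -/
noncomputable def Omega : ℤ → ShMod A X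
  | .ofNat n => (sheafification A X).obj (sectionsAlg f ⋙ formsFunctor A n)
  | .negSucc _ => 0

/-- The exterior derivative `Ω^i_{X/S} ⟶ Ω^{i+1}_{X/S}`. -/
noncomputable def OmegaD : ∀ i : ℤ, Omega f i ⟶ Omega f (i + 1)
  | .ofNat n => (sheafification A X).map (Functor.whiskerLeft (sectionsAlg f) (formsD A n))
  | .negSucc _ => 0

theorem OmegaD_comp : ∀ i : ℤ, OmegaD f i ≫ OmegaD f (i + 1) = 0
  | .ofNat n => by
    refine ((sheafification A X).map_comp _ _).symm.trans ?_
    rw [← Functor.whiskerLeft_comp, formsD_comp]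
    exact (sheafification A X).map_zero _ _
  | .negSucc _ => zero_comp

/-- The De Rham complex `Ω^•_{X/S}`, for `S = Spec A`. -/
noncomputable def deRham : CochainComplex (ShMod A X) ℤ :=
  CochainComplex.of (Omega f) (OmegaD f) (OmegaD_comp f)

/-- `f : X ⟶ Spec A` is projective: it factors as a closed immersion into some projective space
over `A` followed by the structure morphism. -/
def IsProjective : Prop :=
  ∃ (n : ℕ) (i : X ⟶ ProjSpace A n), IsClosedImmersion i ∧ i ≫ ProjSpace.toSpec A n = f

variable (A X) in
/-- Hypercohomology of a complex of sheaves of `A`-modules on `X`. -/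
noncomputable abbrev XHyperH (K : CochainComplex (ShMod A X) ℤ) (m : ℤ) :
    ModuleCat.{u + 1} A :=
  HyperH A (unitSheaf A X) K m

variable (A X) in
/-- Cohomology of a sheaf of `A`-modules on `X`. -/
noncomputable abbrev XSheafH (F : ShMod A X) (j : ℤ) : ModuleCat.{u + 1} A :=
  SheafH A (unitSheaf A X) F j

/-- The complex `Ω^•_{X/S} / N`. -/
noncomputable abbrev deRhamMod (N : ℕ) : CochainComplex (ShMod A X) ℤ := cplxMod (deRham f) N

/-- The De Rham cohomology `H_DR^m(X/S)`. -/
noncomputable abbrev HDR (m : ℤ) : ModuleCat.{u + 1} A := XHyperH A X (deRham f) m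

/-- The Hodge cohomology `H^j(X, Ω^i_{X/S})`. -/
noncomputable abbrev HHodge (i j : ℤ) : ModuleCat.{u + 1} A := XSheafH A X (Omega f i) j

/-- The map `H^j(X, Z_N Ω^i_{X/S}) → H^j(X, Ω^i_{X/S})`. -/
noncomputable def closedModCohMap (N : ℕ) (i j : ℤ) :
    XSheafH A X (closedMod (deRham f) N i) j →ₗ[A] HHodge f i j :=
  sheafHMap A (unitSheaf A X) (closedModι (deRham f) N i) j

/-- The De Rham cohomology modulo `N`: the hypercohomology `ℍ^m(X, Ω^•_{X/S} / N)`. -/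
noncomputable abbrev HDRmod (N : ℕ) (m : ℤ) : ModuleCat.{u + 1} A := XHyperH A X (deRhamMod f N) m

/-- The reduction map `H_DR^m(X/S) → ℍ^m(X, Ω^•_{X/S} / N)`. -/
noncomputable def redDR (N : ℕ) (m : ℤ) : HDR f m →ₗ[A] HDRmod f N m :=
  hyperHMap A (unitSheaf A X) (cplxModπ (deRham f) N) m

/-- The canonical map `H_DR^m(X/S) / N → ℍ^m(X, Ω^•_{X/S} / N)`. -/
noncomputable def compDR (N : ℕ) (m : ℤ) : ModBy A (HDR f m) N →ₗ[A] HDRmod f N m :=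
  hyperHModMap A (unitSheaf A X) (cplxModπ (deRham f) N) N (nsmul_cplxModπ _ N) m

/-- The canonical map `H^j(X, Ω^i_{X/S}) / N → H^j(X, Ω^i_{X/S} / N)`. -/
noncomputable def compHodge (N : ℕ) (i j : ℤ) : ModBy A (HHodge f i j) N →ₗ[A]
    XSheafH A X ((deRhamMod f N).X i) j :=
  hyperHModMap A (unitSheaf A X) _ N (nsmul_single (deRham f) N i) j

/-- The Hodge filtration `Fil_Hodge^i` of `H_DR^m(X/S)`. -/
noncomputable def FilHodgeDR (i m : ℤ) : Submodule A (HDR f m) :=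
  filHodge A (unitSheaf A X) (deRham f) i m

/-- The Hodge filtration `Fil_Hodge^i` of `ℍ^m(X, Ω^•_{X/S} / N)`. -/
noncomputable def FilHodgeMod (N : ℕ) (i m : ℤ) : Submodule A (HDRmod f N m) :=
  filHodge A (unitSheaf A X) (deRhamMod f N) i m

/-- The conjugate filtration `Fil^con_i` of `ℍ^m(X, Ω^•_{X/S} / N)`. -/
noncomputable def FilConMod (N : ℕ) (i m : ℤ) : Submodule A (HDRmod f N m) :=
  filCon A (unitSheaf A X) (deRhamMod f N) i m

/-- The map from `ℍ^m(X, (Ω^•_{X/S} / N)^{• ≥ i})` to `H^{m-i}(X, Ω^i_{X/S} / N)`. -/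
noncomputable def hodgeGrMod (N : ℕ) (i m : ℤ) :
    XHyperH A X (stupidGE (deRhamMod f N) i) m →ₗ[A]
      XSheafH A X ((deRhamMod f N).X i) (m - i) :=
  hodgeGr A (unitSheaf A X) (deRhamMod f N) i m

/-- The map from `ℍ^m(X, (Ω^•_{X/S} / N)^{• ≥ i})` to `ℍ^m(X, Ω^•_{X/S} / N)`, whose image is
`Fil_Hodge^i`. -/
noncomputable def fromHodgeMod (N : ℕ) (i m : ℤ) :
    XHyperH A X (stupidGE (deRhamMod f N) i) m →ₗ[A] HDRmod f N m :=
  hyperHMap A (unitSheaf A X) (stupidGEι (deRhamMod f N) i) m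

end

end DeRhamMod

open DeRhamMod

/-! Write K for the De Rham complex, L = K/N, and H for hypercohomology. Since Z_N K^i is the
preimage of ker d under K^i → L^i, the quotient K^i / Z_N K^i is L^i / ker d. The hypothesis on Z_N
therefore says that every sheaf L^i / ker d has zero cohomology in all degrees
(`boundariesAcyclic_cplxMod`).

The subcomplexes t_{≤ i} L and L^{• ≥ i+1} meet in zero, and their sum differs from L only by L^i /
ker d in degree i. Hence L^{• ≥ i+1} → L / t_{≤ i} L is an isomorphism on H
(`BoundariesAcyclic.bijective_stupidGEToQuot`). This map factors through L, so H(L^{• ≥ i+1})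
injects into H(L), and its image is complementary to the kernel of H(L) → H(L / t_{≤ i} L), which is
the conjugate filtration. Injectivity also makes H(L^{• ≥ i}) → H(L^i[-i]) surjective; linear
algebra then identifies the intersections of the two filtrations and splits H(L).

It remains to compare L with K. Multiplication by N is injective on K^i, because locally the forms
are projective modules over a ℤ-flat ring; it is injective on H(K) and on Hodge cohomology, because
these are free and N is regular on A. The sequences K → K → L and K^i → K^i → L^i then give the
comparison maps modulo N. For the Hodge filtration one needs H(K^{• ≥ j}) to have no N-torsion
(`eq_zero_of_smul_stupidGE_eq_zero`). Torsion dies in H(K), and the injectivity for L shows that the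
kernel of H(K^{• ≥ j}) → H(K) is N-divisible. Krull's intersection theorem, applied to the free
graded pieces K^j one after another, yields for each x in this kernel some a with x = aNx
(`exists_mul_smul_eq_of_stupidGEι_eq_zero`); if moreover Nx = 0, then x = 0. -/

namespace DeRhamMod

/-! ### Long exact sequences and vanishing of hypercohomology. -/

section LongExact
variable {𝒜 : Type u} [Category.{v} 𝒜] [Abelian 𝒜] [HasDerivedCategory.{w} 𝒜] (R : Type t)
  [CommRing R] [Linear R 𝒜] (I : 𝒜)

theorem hyperHMap_comp {K L M : CochainComplex 𝒜 ℤ} (φ : K ⟶ L) (ψ : L ⟶ M) (m : ℤ)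
    (x : HyperH R I K m) :
    hyperHMap R I (φ ≫ ψ) m x = hyperHMap R I ψ m (hyperHMap R I φ m x) :=
  (congrArg (fun g => Linear.rightComp R _ g x) (by rw [Functor.map_comp, Functor.map_comp])).trans
    (Category.assoc _ _ _).symm

theorem hyperHMap_id (K : CochainComplex 𝒜 ℤ) (m : ℤ) (x : HyperH R I K m) :
    hyperHMap R I (𝟙 K) m x = x :=
  (congrArg (fun g => Linear.rightComp R _ g x) (by rw [CategoryTheory.Functor.map_id, CategoryTheory.Functor.map_id])).trans
    (Category.comp_id _)

theorem hyperHMap_nsmul {K L : CochainComplex 𝒜 ℤ} (φ : K ⟶ L) (N : ℕ) (m : ℤ)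
    (x : HyperH R I K m) : hyperHMap R I (N • φ) m x = (N : R) • hyperHMap R I φ m x := by
  rw [Nat.cast_smul_eq_nsmul]
  change (show (DerivedCategory.singleFunctor 𝒜 0).obj I ⟶
    (shiftFunctor (DerivedCategory 𝒜) m).obj (DerivedCategory.Q.obj K) from x) ≫ _ = _
  rw [Functor.map_nsmul, Functor.map_nsmul, Preadditive.comp_nsmul]
  rfl

theorem hyperHMap_zero {K L : CochainComplex 𝒜 ℤ} (m : ℤ) (x : HyperH R I K m) :
    hyperHMap R I (0 : K ⟶ L) m x = 0 := by
  change (show (DerivedCategory.singleFunctor 𝒜 0).obj I ⟶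
    (shiftFunctor (DerivedCategory 𝒜) m).obj (DerivedCategory.Q.obj K) from x) ≫ _ = _
  rw [Functor.map_zero, Functor.map_zero]
  exact comp_zero

theorem hyperHMap_bijective_of_isIso {K L : CochainComplex 𝒜 ℤ} (φ : K ⟶ L) [IsIso φ] (m : ℤ) :
    Function.Bijective (hyperHMap R I φ m) := by
  refine Function.bijective_iff_has_inverse.2 ⟨hyperHMap R I (inv φ) m, fun x => ?_, fun x => ?_⟩
  · rw [← hyperHMap_comp, IsIso.hom_inv_id, hyperHMap_id]
  · rw [← hyperHMap_comp, IsIso.inv_hom_id, hyperHMap_id]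

variable {S : ShortComplex (CochainComplex 𝒜 ℤ)}

theorem hyperHMap_exact (hS : S.ShortExact) (m : ℤ) (x : HyperH R I S.X₂ m) :
    hyperHMap R I S.g m x = 0 ↔ ∃ y, hyperHMap R I S.f m y = x := by
  constructor
  · intro hx
    have h := (preadditiveCoyoneda.obj (.op ((DerivedCategory.singleFunctor 𝒜 0).obj I))
      ).homologySequence_exact₂
      _ (DerivedCategory.triangleOfSES_distinguished hS) m
    rw [ShortComplex.ab_exact_iff] at h
    exact h x hx
  · rintro ⟨y, rfl⟩
    rw [← hyperHMap_comp, S.zero, hyperHMap_zero]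

/-- Both conditions say that the connecting map from degree m of the third term to degree m' = m + 1
of the first one vanishes. -/
theorem hyperHMap_surjective_iff_injective (hS : S.ShortExact) (m m' : ℤ) (hm : m + 1 = m') :
    Function.Surjective (hyperHMap R I S.g m) ↔ Function.Injective (hyperHMap R I S.f m') := by
  have hT := DerivedCategory.triangleOfSES_distinguished hS
  have h3 := (preadditiveCoyoneda.obj (.op ((DerivedCategory.singleFunctor 𝒜 0).obj I))
      ).homologySequence_epi_shift_map_mor₂_iff
    _ hT m m' hm
  have h1 := (preadditiveCoyoneda.obj (.op ((DerivedCategory.singleFunctor 𝒜 0).obj I))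
      ).homologySequence_mono_shift_map_mor₁_iff
    _ hT m m' hm
  rw [← h1, AddCommGrpCat.epi_iff_surjective, AddCommGrpCat.mono_iff_injective] at h3
  exact h3

theorem hyperHMap_bijective_of_right_acyclic (hS : S.ShortExact)
    (h : ∀ m, Subsingleton (HyperH R I S.X₃ m)) (m : ℤ) :
    Function.Bijective (hyperHMap R I S.f m) := by
  refine ⟨?_, fun x => ?_⟩
  · refine (hyperHMap_surjective_iff_injective R I hS (m - 1) m (by omega)).1 fun x => ⟨0, ?_⟩
    have := h (m - 1)
    exact Subsingleton.elim _ _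
  · have := h m
    exact (hyperHMap_exact R I hS m x).1 (Subsingleton.elim _ _)

theorem right_acyclic_of_bijective (hS : S.ShortExact)
    (h : ∀ m, Function.Bijective (hyperHMap R I S.f m)) (m : ℤ) :
    Subsingleton (HyperH R I S.X₃ m) := by
  refine subsingleton_of_forall_eq 0 fun x => ?_
  obtain ⟨y, rfl⟩ := (hyperHMap_surjective_iff_injective R I hS m (m + 1) rfl).2 (h _).1 x
  exact (hyperHMap_exact R I hS m y).2 ((h m).2 y)

/-- For the standard t-structure there are no morphisms from an object in degrees ≤ 0 to one in
degrees > 0, and K[m] lives in degrees ≥ j - m > 0. -/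
theorem hyperH_subsingleton_of_isStrictlyGE (K : CochainComplex 𝒜 ℤ) (j m : ℤ)
    [K.IsStrictlyGE j] (hm : m < j) : Subsingleton (HyperH R I K m) := by
  refine subsingleton_of_forall_eq 0 fun x => ?_
  have h1 : (DerivedCategory.Q.obj K).IsGE j := inferInstance
  have h2 := (DerivedCategory.TStructure.t (C := 𝒜)).isGE_shift (DerivedCategory.Q.obj K) j m (j - m)
    (by omega)
  exact (DerivedCategory.TStructure.t (C := 𝒜)).zero_of_isLE_of_isGE _ 0 (j - m) (by omega)
    inferInstance h2

theorem hyperH_subsingleton_of_isZero (K : CochainComplex 𝒜 ℤ) (hK : IsZero K) (m : ℤ) :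
    Subsingleton (HyperH R I K m) := by
  refine subsingleton_of_forall_eq 0 fun x => ?_
  rw [← hyperHMap_id R I K m x, hK.eq_of_src (𝟙 K) 0, hyperHMap_zero]

end LongExact

/-! ### Reduction modulo N and the stupid truncations. -/

section Complexes
variable {𝒜 : Type u} [Category.{v} 𝒜] [Abelian 𝒜]

/-- The short complex `K ⟶ K ⟶ K / N K`. -/
noncomputable abbrev cplxModSC (K : CochainComplex 𝒜 ℤ) (N : ℕ) :
    ShortComplex (CochainComplex 𝒜 ℤ) :=
  ShortComplex.mk (N • 𝟙 K) (cplxModπ K N) (cokernel.condition _)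

theorem cplxModSC_shortExact (K : CochainComplex 𝒜 ℤ) (N : ℕ) (h : ∀ i, Mono (N • 𝟙 (K.X i))) :
    (cplxModSC K N).ShortExact where
  exact := ShortComplex.exact_of_g_is_cokernel _ (cokernelIsCokernel _)
  mono_f := HomologicalComplex.mono_of_mono_f _ fun i => by
    simpa using h i

theorem nsmul_comp_cplxModπ_f (K : CochainComplex 𝒜 ℤ) (N : ℕ) (i : ℤ) :
    (N • 𝟙 (K.X i)) ≫ (cplxModπ K N).f i = 0 := by
  rw [Preadditive.nsmul_comp, Category.id_comp, ← HomologicalComplex.nsmul_f_apply,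
    nsmul_cplxModπ]
  simp

/-- The short complex `Kⁱ ⟶ Kⁱ ⟶ (K / N K)ⁱ`. -/
noncomputable abbrev cplxModXSC (K : CochainComplex 𝒜 ℤ) (N : ℕ) (i : ℤ) : ShortComplex 𝒜 :=
  ShortComplex.mk _ _ (nsmul_comp_cplxModπ_f K N i)

/-- Exactness of complexes is degreewise, so the cokernel of N on complexes is the cokernel of N in
each degree. -/
theorem cplxModXSC_exact (K : CochainComplex 𝒜 ℤ) (N : ℕ) (i : ℤ) :
    (cplxModXSC K N i).Exact := by
  have h := (HomologicalComplex.exact_iff_degreewise_exact (cplxModSC K N)).1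
    (ShortComplex.exact_of_g_is_cokernel _ (cokernelIsCokernel _)) i
  refine ShortComplex.exact_of_iso (ShortComplex.isoMk (Iso.refl _) (Iso.refl _) (Iso.refl _)
    ?_ ?_) h
  · simp
  · simp

instance (K : CochainComplex 𝒜 ℤ) (N : ℕ) (i : ℤ) : Epi ((cplxModπ K N).f i) :=
  inferInstanceAs (Epi ((HomologicalComplex.eval 𝒜 _ i).map (cplxModπ K N)))

theorem cplxModXSC_shortExact (K : CochainComplex 𝒜 ℤ) (N : ℕ) (i : ℤ)
    (h : Mono (N • 𝟙 (K.X i))) : (cplxModXSC K N i).ShortExact where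
  exact := cplxModXSC_exact K N i
  mono_f := h
  epi_g := inferInstanceAs (Epi ((cplxModπ K N).f i))

theorem _root_.CategoryTheory.ShortComplex.ShortExact.mk_of_isZero_of_isIso {S : ShortComplex 𝒜}
    (h : IsZero S.X₁) (hg : IsIso S.g) : S.ShortExact :=
  (ShortComplex.Splitting.ofIsZeroOfIsIso S h hg).shortExact

theorem _root_.CategoryTheory.ShortComplex.ShortExact.mk_of_isIso_of_isZero {S : ShortComplex 𝒜}
    (hf : IsIso S.f) (h : IsZero S.X₃) : S.ShortExact :=
  (ShortComplex.Splitting.ofIsIsoOfIsZero S hf h).shortExact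

/-- The map `K^{• ≥ i} ⟶ L^{• ≥ i}` induced by a map of complexes. -/
noncomputable abbrev stupidGEMap {K L : CochainComplex 𝒜 ℤ} (φ : K ⟶ L) (i : ℤ) :
    stupidGE K i ⟶ stupidGE L i :=
  HomologicalComplex.stupidTruncMap φ (ComplexShape.embeddingUpIntGE i)

theorem stupidGEMap_f_comp {K L : CochainComplex 𝒜 ℤ} (φ : K ⟶ L) {i j : ℤ} (h : i ≤ j) :
    (stupidGEMap φ i).f j ≫ (stupidGEXIso L h).hom = (stupidGEXIso K h).hom ≫ φ.f j :=
  HomologicalComplex.stupidTruncMap_stupidTruncXIso_hom _ _ _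

theorem stupidGEι_f_of_le (K : CochainComplex 𝒜 ℤ) {i j : ℤ} (h : i ≤ j) :
    (stupidGEι K i).f j = (stupidGEXIso K h).hom := dif_pos h

instance (K : CochainComplex 𝒜 ℤ) (i j : ℤ) : Mono ((stupidGEι K i).f j) := by
  by_cases h : i ≤ j
  · rw [stupidGEι_f_of_le K h]; infer_instance
  · exact (isZero_stupidGE_X K (not_le.1 h)).mono _

instance (K : CochainComplex 𝒜 ℤ) (i : ℤ) : Mono (stupidGEι K i) :=
  HomologicalComplex.mono_of_mono_f _ inferInstance

theorem stupidGEMap_comp_ι {K L : CochainComplex 𝒜 ℤ} (φ : K ⟶ L) (i : ℤ) :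
    stupidGEMap φ i ≫ stupidGEι L i = stupidGEι K i ≫ φ := by
  ext j
  by_cases h : i ≤ j
  · simp only [HomologicalComplex.comp_f, stupidGEι_f_of_le _ h]
    exact stupidGEMap_f_comp φ h
  · exact (isZero_stupidGE_X K (not_le.1 h)).eq_of_src _ _

theorem stupidGEMap_zero (K L : CochainComplex 𝒜 ℤ) (i : ℤ) :
    stupidGEMap (0 : K ⟶ L) i = 0 := by
  rw [← cancel_mono (stupidGEι L i), stupidGEMap_comp_ι, comp_zero, zero_comp]

theorem stupidGEMap_nsmul_id (K : CochainComplex 𝒜 ℤ) (N : ℕ) (i : ℤ) :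
    stupidGEMap (N • 𝟙 K) i = N • 𝟙 (stupidGE K i) := by
  rw [← cancel_mono (stupidGEι K i), stupidGEMap_comp_ι, Preadditive.comp_nsmul,
    Preadditive.nsmul_comp, Category.comp_id, Category.id_comp]

/-- The short complex of the `S^{• ≥ i}`. -/
noncomputable abbrev stupidGESC (S : ShortComplex (CochainComplex 𝒜 ℤ)) (i : ℤ) :
    ShortComplex (CochainComplex 𝒜 ℤ) :=
  ShortComplex.mk (stupidGEMap S.f i) (stupidGEMap S.g i) (by
    rw [← HomologicalComplex.stupidTruncMap_comp, S.zero]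
    exact stupidGEMap_zero _ _ i)

theorem stupidGESC_shortExact {S : ShortComplex (CochainComplex 𝒜 ℤ)} (hS : S.ShortExact) (i : ℤ) :
    (stupidGESC S i).ShortExact := by
  refine HomologicalComplex.shortExact_of_degreewise_shortExact _ fun j => ?_
  by_cases h : i ≤ j
  · refine ShortComplex.shortExact_of_iso ?_
      ((HomologicalComplex.shortExact_iff_degreewise_shortExact S).1 hS j)
    exact (ShortComplex.isoMk (S₁ := (stupidGESC S i).map (HomologicalComplex.eval _ _ j))
      (S₂ := S.map (HomologicalComplex.eval _ _ j)) (stupidGEXIso S.X₁ h) (stupidGEXIso S.X₂ h)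
      (stupidGEXIso S.X₃ h) (stupidGEMap_f_comp S.f h).symm (stupidGEMap_f_comp S.g h).symm).symm
  · exact .mk_of_isZero_of_isIso (isZero_stupidGE_X _ (not_le.1 h))
      (IsZero.isIso (isZero_stupidGE_X _ (not_le.1 h)) (isZero_stupidGE_X _ (not_le.1 h)) _)

/-- The inclusion `K^{• ≥ i + 1} ⟶ K^{• ≥ i}`. -/
noncomputable def stupidGESucc (K : CochainComplex 𝒜 ℤ) (i : ℤ) :
    stupidGE K (i + 1) ⟶ stupidGE K i where
  f j := if h : i + 1 ≤ j then
    (stupidGEXIso K h).hom ≫ (stupidGEXIso K (by omega : i ≤ j)).inv else 0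
  comm' j k hjk := by
    -- Both truncations embed in K, where compatibility with d can be tested.
    rw [← cancel_mono ((stupidGEι K i).f k)]
    by_cases hj : i + 1 ≤ j
    · have hk : i + 1 ≤ k := by have : j + 1 = k := hjk; omega
      rw [dif_pos hj, dif_pos hk, Category.assoc, Category.assoc, ← (stupidGEι K i).comm,
        stupidGEι_f_of_le K (by omega : i ≤ j), stupidGEι_f_of_le K (by omega : i ≤ k),
        Category.assoc, Category.assoc, Iso.inv_hom_id, Iso.inv_hom_id_assoc, Category.comp_id]
      exact (stupidTrunc_d_comp K _ _ _).symm
    · exact (isZero_stupidGE_X K (not_le.1 hj)).eq_of_src _ _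

theorem stupidGESucc_comp_ι (K : CochainComplex 𝒜 ℤ) (i : ℤ) :
    stupidGESucc K i ≫ stupidGEι K i = stupidGEι K (i + 1) := by
  ext j
  by_cases h : i + 1 ≤ j
  · rw [HomologicalComplex.comp_f, stupidGEι_f_of_le _ (by omega : i ≤ j), stupidGEι_f_of_le _ h]
    change dite _ _ _ ≫ _ = _
    rw [dif_pos h, Category.assoc, Iso.inv_hom_id, Category.comp_id]
  · exact (isZero_stupidGE_X K (not_le.1 h)).eq_of_src _ _

/-- The short complex `K^{• ≥ i + 1} ⟶ K^{• ≥ i} ⟶ K^i[-i]`. -/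
noncomputable abbrev stupidGESuccSC (K : CochainComplex 𝒜 ℤ) (i : ℤ) :
    ShortComplex (CochainComplex 𝒜 ℤ) :=
  ShortComplex.mk (stupidGESucc K i) (stupidGEToSingle K i) (by
    apply HomologicalComplex.to_single_hom_ext
    exact (isZero_stupidGE_X K (by omega)).eq_of_src _ _)

theorem stupidGESuccSC_shortExact (K : CochainComplex 𝒜 ℤ) (i : ℤ) :
    (stupidGESuccSC K i).ShortExact := by
  refine HomologicalComplex.shortExact_of_degreewise_shortExact _ fun j => ?_
  obtain h | rfl | h := lt_trichotomy j i
  · exact .mk_of_isZero_of_isIso (isZero_stupidGE_X _ (by omega))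
      (IsZero.isIso (isZero_stupidGE_X _ h)
        (HomologicalComplex.isZero_single_obj_X (.up ℤ) _ _ _ (by omega)) _)
  · refine .mk_of_isZero_of_isIso (isZero_stupidGE_X K (lt_add_one j)) ?_
    change IsIso ((stupidGEToSingle K j).f j)
    rw [stupidGEToSingle, HomologicalComplex.mkHomToSingle_f]
    exact @IsIso.comp_isIso _ _ _ _ _ _ _ (Iso.isIso_hom _) (Iso.isIso_inv _)
  · refine .mk_of_isIso_of_isZero ?_ (HomologicalComplex.isZero_single_obj_X (.up ℤ) _ _ _ (by omega))
    change IsIso ((stupidGESucc K i).f j)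
    rw [stupidGESucc]
    dsimp only
    rw [dif_pos (by omega : i + 1 ≤ j)]
    infer_instance

instance (K : CochainComplex 𝒜 ℤ) (i : ℤ) : (stupidGE K i).IsStrictlyGE i := by
  rw [CochainComplex.isStrictlyGE_iff]
  exact fun j hj => isZero_stupidGE_X K hj

theorem isIso_stupidGEι (K : CochainComplex 𝒜 ℤ) (i : ℤ) [K.IsStrictlyGE i] :
    IsIso (stupidGEι K i) := by
  have : ∀ j, IsIso ((stupidGEι K i).f j) := fun j => by
    by_cases h : i ≤ j
    · rw [stupidGEι_f_of_le K h]; infer_instance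
    · exact IsZero.isIso (isZero_stupidGE_X K (not_le.1 h))
        (K.isZero_of_isStrictlyGE i j (not_le.1 h)) _
  exact HomologicalComplex.Hom.isIso_of_components _

end Complexes

/-! ### The canonical truncation, its quotient, and the sheaves Z_N. -/

section Truncation
variable {𝒜 : Type u} [Category.{v} 𝒜] [Abelian 𝒜]

/-- The truncation is dual to `πTruncGE` of the opposite complex, which changes the complex inside
its range only at the boundary degree i. -/
theorem isIso_ιTruncLE_f (K : CochainComplex 𝒜 ℤ) {i j : ℤ} (h : j < i) :
    IsIso ((K.ιTruncLE i).f j) := by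
  let e := ComplexShape.embeddingUpIntLE i
  have hj : e.f (i - j).toNat = j := by
    change i - ((i - j).toNat : ℤ) = j
    omega
  have hb : ¬ e.op.BoundaryGE (i - j).toNat := by
    rw [ComplexShape.Embedding.op_boundaryGE_iff, ComplexShape.boundaryLE_embeddingUpIntLE_iff]
    omega
  change IsIso ((HomologicalComplex.πTruncGE (HomologicalComplex.op K) e.op).f j).unop
  have h1 := (HomologicalComplex.op K).isIso_restrictionToTruncGE' e.op _ hb
  have : IsIso ((HomologicalComplex.πTruncGE (HomologicalComplex.op K) e.op).f j) :=
    (e.op.isIso_liftExtend_f_iff _ _ hj).2 h1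
  infer_instance

/-- The quotient of `K` by its canonical truncation `t_{≤ i} K`. -/
noncomputable abbrev quotTruncLE (K : CochainComplex 𝒜 ℤ) (i : ℤ) : CochainComplex 𝒜 ℤ :=
  (K.shortComplexTruncLE i).X₃

/-- The projection of `K` onto its quotient by the canonical truncation. -/
noncomputable abbrev quotTruncLEπ (K : CochainComplex 𝒜 ℤ) (i : ℤ) : K ⟶ quotTruncLE K i :=
  (K.shortComplexTruncLE i).g

theorem shortExact_truncLE_f (K : CochainComplex 𝒜 ℤ) (i j : ℤ) :
    ((K.shortComplexTruncLE i).map (HomologicalComplex.eval 𝒜 (.up ℤ) j)).ShortExact :=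
  (HomologicalComplex.shortExact_iff_degreewise_shortExact _).1
    (K.shortComplexTruncLE_shortExact i) j

theorem isIso_quotTruncLEπ_f (K : CochainComplex 𝒜 ℤ) {i j : ℤ} (h : i < j) :
    IsIso ((quotTruncLEπ K i).f j) :=
  (shortExact_truncLE_f K i j).isIso_g_iff.2 ((K.truncLE i).isZero_of_isStrictlyLE i j h)

theorem isZero_quotTruncLE_X (K : CochainComplex 𝒜 ℤ) {i j : ℤ} (h : j < i) :
    IsZero ((quotTruncLE K i).X j) :=
  (shortExact_truncLE_f K i j).isIso_f_iff.1 (isIso_ιTruncLE_f K h)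

/-- In degree i the quotient is K^i / ker d. Formally, the quotient complex is exact at i and its
term in degree i - 1 is zero. -/
theorem mono_quotTruncLE_d (K : CochainComplex 𝒜 ℤ) (i : ℤ) :
    Mono ((quotTruncLE K i).d i (i + 1)) := by
  have h : (quotTruncLE K i).ExactAt i := by
    have := (K.shortComplexTruncLE_X₃_isSupportedOutside (ComplexShape.embeddingUpIntLE i)).exactAt 0
    simpa using this
  rw [HomologicalComplex.exactAt_iff' _ (i - 1) i (i + 1) (by simp) (by simp)] at h
  exact h.mono_g ((isZero_quotTruncLE_X K (by omega)).eq_of_src _ _)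

/-- The map `K^{• ≥ i + 1} ⟶ K / t_{≤ i} K`. -/
noncomputable abbrev stupidGEToQuot (K : CochainComplex 𝒜 ℤ) (i : ℤ) :
    stupidGE K (i + 1) ⟶ quotTruncLE K i :=
  stupidGEι K (i + 1) ≫ quotTruncLEπ K i

theorem isIso_stupidGEToQuot_f (K : CochainComplex 𝒜 ℤ) {i j : ℤ} (h : i < j) :
    IsIso ((stupidGEToQuot K i).f j) := by
  have := isIso_quotTruncLEπ_f K h
  rw [HomologicalComplex.comp_f, stupidGEι_f_of_le _ (by omega : i + 1 ≤ j)]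
  infer_instance

/-- The quotient of `K` by the sum of its subcomplexes `K^{• ≥ i + 1}` and `t_{≤ i} K`. -/
noncomputable abbrev stupidGEQuotSC (K : CochainComplex 𝒜 ℤ) (i : ℤ) :
    ShortComplex (CochainComplex 𝒜 ℤ) :=
  ShortComplex.mk (stupidGEToQuot K i) (cokernel.π _) (cokernel.condition _)

/-- The two subcomplexes meet in zero: in degrees > i the map is an isomorphism, and in the
remaining degrees its source vanishes. -/
theorem stupidGEQuotSC_shortExact (K : CochainComplex 𝒜 ℤ) (i : ℤ) :
    (stupidGEQuotSC K i).ShortExact where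
  exact := ShortComplex.exact_of_g_is_cokernel _ (cokernelIsCokernel _)
  mono_f := HomologicalComplex.mono_of_mono_f _ fun j => by
    by_cases h : i < j
    · have := isIso_stupidGEToQuot_f K h
      infer_instance
    · exact (isZero_stupidGE_X K (by omega)).mono _

theorem stupidGEQuotSC_shortExact_f (K : CochainComplex 𝒜 ℤ) (i j : ℤ) :
    ((stupidGEQuotSC K i).map (HomologicalComplex.eval 𝒜 (.up ℤ) j)).ShortExact :=
  (HomologicalComplex.shortExact_iff_degreewise_shortExact _).1 (stupidGEQuotSC_shortExact K i) j

instance (K : CochainComplex 𝒜 ℤ) (i : ℤ) : (stupidGEQuotSC K i).X₃.IsStrictlyGE i := by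
  rw [CochainComplex.isStrictlyGE_iff]
  intro j hj
  have h := (stupidGEQuotSC_shortExact_f K i j).epi_g
  exact @IsZero.of_epi _ _ _ _ _ _ h (isZero_quotTruncLE_X K hj)

instance (K : CochainComplex 𝒜 ℤ) (i : ℤ) : (stupidGEQuotSC K i).X₃.IsStrictlyLE i := by
  rw [CochainComplex.isStrictlyLE_iff]
  exact fun j hj => (stupidGEQuotSC_shortExact_f K i j).isIso_f_iff.1 (isIso_stupidGEToQuot_f K hj)

/-- The sum of the subcomplexes `K^{• ≥ i + 1}` and `t_{≤ i} K` differs from `K` only in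
degree `i`. -/
theorem stupidGEQuot_iso_single (K : CochainComplex 𝒜 ℤ) (i : ℤ) :
    Nonempty ((stupidGEQuotSC K i).X₃ ≅
      (CochainComplex.singleFunctor 𝒜 i).obj ((quotTruncLE K i).X i)) := by
  obtain ⟨M, ⟨e⟩⟩ := (stupidGEQuotSC K i).X₃.exists_iso_single i
  have h1 : IsIso ((stupidGEQuotSC K i).map (HomologicalComplex.eval 𝒜 (.up ℤ) i)).g :=
    (stupidGEQuotSC_shortExact_f K i i).isIso_g_iff.2 (isZero_stupidGE_X K (lt_add_one i))
  exact ⟨e ≪≫ (CochainComplex.singleFunctor 𝒜 i).mapIso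
    ((HomologicalComplex.singleObjXSelf (.up ℤ) i M).symm ≪≫
      (HomologicalComplex.eval 𝒜 (.up ℤ) i).mapIso e.symm ≪≫ (asIso
      ((stupidGEQuotSC K i).map (HomologicalComplex.eval 𝒜 (.up ℤ) i)).g).symm)⟩

/-- The target L^i / ker d embeds by d into degree i + 1, where the claim becomes dω ∈ N K^{i+1}. -/
theorem closedModι_comp (K : CochainComplex 𝒜 ℤ) (N : ℕ) (i : ℤ) :
    closedModι K N i ≫ (cplxModπ K N).f i ≫ (quotTruncLEπ (cplxMod K N) i).f i = 0 := by
  have := mono_quotTruncLE_d (cplxMod K N) i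
  rw [← cancel_mono ((quotTruncLE (cplxMod K N) i).d i (i + 1)), zero_comp, Category.assoc,
    Category.assoc, (quotTruncLEπ (cplxMod K N) i).comm, (cplxModπ K N).comm_assoc]
  have h : closedModι K N i ≫ K.d i (i + 1) ≫ (cplxModπ K N).f (i + 1) = 0 := by
    rw [← cokernel.π_desc (N • 𝟙 (K.X (i + 1))) _ (nsmul_comp_cplxModπ_f K N (i + 1)),
      ← Category.assoc, ← Category.assoc]
    rw [Category.assoc (closedModι K N i), kernel.condition, zero_comp]
  rw [reassoc_of% h, zero_comp]

/-- The quotient of `Kⁱ` by `Z_N Kⁱ`, as a short complex. -/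
noncomputable abbrev closedModSC (K : CochainComplex 𝒜 ℤ) (N : ℕ) (i : ℤ) : ShortComplex 𝒜 :=
  ShortComplex.mk _ _ (closedModι_comp K N i)

/-- This is K^i / Z_N K^i ≅ L^i / ker d. The maps from K^i to K^{i+1}/N and to L^i / ker d become
equal after monomorphisms into degree i + 1 of L / t_{≤ i} L, so they have the same kernel. The
complexes `S` and `closedModSC` are compared with the common complex `T` for this. -/
theorem closedModSC_shortExact (K : CochainComplex 𝒜 ℤ) (N : ℕ) (i : ℤ) :
    (closedModSC K N i).ShortExact where
  mono_f := inferInstanceAs (Mono (kernel.ι _))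
  epi_g := by
    have := (shortExact_truncLE_f (cplxMod K N) i i).epi_g
    exact @epi_comp _ _ _ _ _ ((cplxModπ K N).f i) inferInstance _ this
  exact := by
    let S : ShortComplex 𝒜 := ShortComplex.mk _ _
      (kernel.condition (K.d i (i + 1) ≫ cokernel.π (N • 𝟙 (K.X (i + 1)))))
    have hS : S.Exact := ShortComplex.exact_of_f_is_kernel _ (kernelIsKernel _)
    have h1 : Mono (cokernel.desc (N • 𝟙 (K.X (i + 1))) _ (nsmul_comp_cplxModπ_f K N (i + 1))) :=
      (cplxModXSC_exact K N (i + 1)).mono_cokernelDesc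
    have h2 := mono_quotTruncLE_d (cplxMod K N) i
    have h3 := isIso_quotTruncLEπ_f (cplxMod K N) (lt_add_one i)
    have h0 : closedModι K N i ≫ (K.d i (i + 1) ≫ (cplxModπ K N).f (i + 1) ≫
        (quotTruncLEπ (cplxMod K N) i).f (i + 1)) = 0 := by
      have h := closedModι_comp K N i =≫ (quotTruncLE (cplxMod K N) i).d i (i + 1)
      rwa [zero_comp, Category.assoc, Category.assoc, (quotTruncLEπ (cplxMod K N) i).comm,
        (cplxModπ K N).comm_assoc] at h
    let T : ShortComplex 𝒜 := ShortComplex.mk _ _ h0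
    let φ : S ⟶ T :=
      { τ₁ := 𝟙 _
        τ₂ := 𝟙 _
        τ₃ := cokernel.desc (N • 𝟙 (K.X (i + 1))) _ (nsmul_comp_cplxModπ_f K N (i + 1)) ≫
          (quotTruncLEπ (cplxMod K N) i).f (i + 1)
        comm₂₃ := by simp [S, T] }
    let ψ : closedModSC K N i ⟶ T :=
      { τ₁ := 𝟙 _
        τ₂ := 𝟙 _
        τ₃ := (quotTruncLE (cplxMod K N) i).d i (i + 1)
        comm₂₃ := by
          dsimp only [T]
          rw [Category.id_comp, Category.assoc, (quotTruncLEπ (cplxMod K N) i).comm,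
            (cplxModπ K N).comm_assoc] }
    have e1 : Epi φ.τ₁ := inferInstanceAs (Epi (𝟙 _))
    have e2 : IsIso φ.τ₂ := inferInstanceAs (IsIso (𝟙 _))
    have e3 : Mono φ.τ₃ := mono_comp _ _
    have f1 : Epi ψ.τ₁ := inferInstanceAs (Epi (𝟙 _))
    have f2 : IsIso ψ.τ₂ := inferInstanceAs (IsIso (𝟙 _))
    have f3 : Mono ψ.τ₃ := h2
    exact (ShortComplex.exact_iff_of_epi_of_isIso_of_mono ψ).2
      ((ShortComplex.exact_iff_of_epi_of_isIso_of_mono φ).1 hS)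

theorem single_shortExact {S : ShortComplex 𝒜} (hS : S.ShortExact) (i : ℤ) :
    (S.map (CochainComplex.singleFunctor 𝒜 i)).ShortExact :=
  have := hS.mono_f
  have := hS.epi_g
  have : PreservesFiniteLimits (CochainComplex.singleFunctor 𝒜 i) :=
    inferInstanceAs (PreservesFiniteLimits (HomologicalComplex.single 𝒜 (.up ℤ) i))
  have : PreservesFiniteColimits (CochainComplex.singleFunctor 𝒜 i) :=
    inferInstanceAs (PreservesFiniteColimits (HomologicalComplex.single 𝒜 (.up ℤ) i))
  hS.map _

theorem nsmul_single_shortExact (K : CochainComplex 𝒜 ℤ) (N : ℕ) (i : ℤ)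
    (h : Mono (N • 𝟙 (K.X i))) (h0) :
    (ShortComplex.mk (N • 𝟙 ((CochainComplex.singleFunctor 𝒜 0).obj (K.X i)))
      ((CochainComplex.singleFunctor 𝒜 0).map ((cplxModπ K N).f i)) h0).ShortExact := by
  refine ShortComplex.shortExact_of_iso ?_ (single_shortExact (cplxModXSC_shortExact K N i h) 0)
  refine ShortComplex.isoMk (Iso.refl _) (Iso.refl _) (Iso.refl _) ?_ ?_
  · change 𝟙 _ ≫ (N • 𝟙 _) = (CochainComplex.singleFunctor 𝒜 0).map (N • 𝟙 _) ≫ 𝟙 _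
    rw [Functor.map_nsmul, CategoryTheory.Functor.map_id, Category.id_comp, Category.comp_id]
  · exact (Category.id_comp _).trans (Category.comp_id _).symm

theorem nsmul_stupidGE_shortExact (K : CochainComplex 𝒜 ℤ) (N : ℕ)
    (h : ∀ i, Mono (N • 𝟙 (K.X i))) (i : ℤ) (h0) :
    (ShortComplex.mk (N • 𝟙 (stupidGE K i)) (stupidGEMap (cplxModπ K N) i) h0).ShortExact := by
  refine ShortComplex.shortExact_of_iso ?_ (stupidGESC_shortExact (cplxModSC_shortExact K N h) i)
  refine ShortComplex.isoMk (Iso.refl _) (Iso.refl _) (Iso.refl _) ?_ ?_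
  · exact (Category.id_comp _).trans
      ((stupidGEMap_nsmul_id K N i).symm.trans (Category.comp_id _).symm)
  · exact (Category.id_comp _).trans (Category.comp_id _).symm

theorem nsmul_id_comp_eq_zero {P Q : CochainComplex 𝒜 ℤ} {φ : P ⟶ Q} {N : ℕ} (h : N • φ = 0) :
    (N • 𝟙 P) ≫ φ = 0 := by
  rw [Preadditive.nsmul_comp, Category.id_comp, h]

theorem nsmul_stupidGEMap (K : CochainComplex 𝒜 ℤ) (N : ℕ) (i : ℤ) :
    N • stupidGEMap (cplxModπ K N) i = 0 := by
  rw [← cancel_mono (stupidGEι _ i), Preadditive.nsmul_comp, stupidGEMap_comp_ι,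
    ← Preadditive.comp_nsmul, nsmul_cplxModπ, comp_zero, zero_comp]

end Truncation

/-! ### Krull's intersection theorem and splittings of filtered modules. -/

section LinearAlgebra
variable {R : Type*} [CommRing R]

/-- Krull's intersection theorem for free modules which need not be finite. -/
theorem exists_smul_eq_of_forall_pow_smul [IsNoetherianRing R] {M : Type*} [AddCommGroup M]
    [Module R M] [Module.Free R M] (b : R) (x : M) (h : ∀ k : ℕ, ∃ y : M, b ^ k • y = x) :
    ∃ a : R, (a * b) • x = x := by
  let B := Module.Free.chooseBasis R M
  -- Only finitely many coordinates of x are nonzero, so Krull's theorem in R^s suffices; outside s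
  -- the equation reads 0 = 0.
  let s := (B.repr x).support
  let φ : M →ₗ[R] (s → R) := LinearMap.pi fun i => B.coord i
  have hx : φ x ∈ (⨅ k : ℕ, Ideal.span {b} ^ k • ⊤ : Submodule R (s → R)) := by
    refine (Submodule.mem_iInf _).2 fun k => ?_
    obtain ⟨y, hy⟩ := h k
    rw [← hy, map_smul]
    exact Submodule.smul_mem_smul (Ideal.pow_mem_pow (Ideal.mem_span_singleton_self b) k) trivial
  obtain ⟨⟨r, hr⟩, hrx⟩ := (Ideal.mem_iInf_smul_pow_eq_bot_iff _ _).1 hx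
  obtain ⟨a, rfl⟩ := Ideal.mem_span_singleton'.1 hr
  refine ⟨a, B.repr.injective (Finsupp.ext fun i => ?_)⟩
  by_cases hi : i ∈ s
  · have := congrFun hrx ⟨i, hi⟩
    rw [map_smul]
    exact this
  · rw [map_smul, Finsupp.smul_apply, Finsupp.notMem_support_iff.1 hi, smul_zero]

/-- A complement C of the smaller submodule f(ker g) cuts the larger one, f(Y), in a complement of
f(ker g) there, and f(Y) / f(ker g) ≅ Y / ker g ≅ G. -/
theorem exists_linearEquiv_inf_range {Y H G : Type*} [AddCommGroup Y] [AddCommGroup H]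
    [AddCommGroup G] [Module R Y] [Module R H] [Module R G] (f : Y →ₗ[R] H) (g : Y →ₗ[R] G)
    (hf : Function.Injective f) (hg : Function.Surjective g) (C : Submodule R H)
    (hC : IsCompl C ((LinearMap.ker g).map f)) :
    ∃ e : ↥(C ⊓ LinearMap.range f) ≃ₗ[R] G, ∀ y hy, e ⟨f y, hy⟩ = g y := by
  let φ : ↥(C ⊓ LinearMap.range f) →ₗ[R] G := g ∘ₗ (LinearEquiv.ofInjective f hf).symm.toLinearMap ∘ₗ
    Submodule.inclusion inf_le_right
  have hφ : ∀ y hy, φ ⟨f y, hy⟩ = g y := fun y hy =>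
    congrArg g ((LinearEquiv.symm_apply_eq _).2 (Subtype.ext rfl))
  refine ⟨LinearEquiv.ofBijective φ ⟨(injective_iff_map_eq_zero _).2 ?_, fun s => ?_⟩, hφ⟩
  · rintro ⟨_, hc, y, rfl⟩ h
    have h : g y = 0 := (hφ y _).symm.trans h
    have : f y ∈ C ⊓ (LinearMap.ker g).map f := ⟨hc, y, h, rfl⟩
    rw [hC.inf_eq_bot] at this
    exact Subtype.ext this
  · obtain ⟨y, rfl⟩ := hg s
    have hy : f y ∈ C ⊔ (LinearMap.ker g).map f := by rw [hC.sup_eq_top]; trivial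
    obtain ⟨c, hc, _, ⟨z, hz, rfl⟩, h⟩ := Submodule.mem_sup.1 hy
    have hc' : c = f (y - z) := by rw [map_sub, ← h, add_sub_cancel_right]
    subst hc'
    exact ⟨⟨f (y - z), hc, y - z, rfl⟩, (hφ _ _).trans (by
      rw [map_sub, LinearMap.mem_ker.1 hz, sub_zero])⟩

/-- A filtration with chosen complements splits into its graded pieces. -/
theorem bijective_lsum_of_isCompl {H : Type*} [AddCommGroup H] [Module R H] {n : ℕ}
    (F C : ℕ → Submodule R H) (h0 : F 0 = ⊤) (hn : F n = ⊥) (hF : ∀ i, F (i + 1) ≤ F i)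
    (hC : ∀ i, IsCompl (C i) (F (i + 1))) {M : Fin n → Type*} [∀ i, AddCommGroup (M i)]
    [∀ i, Module R (M i)] (ψ : ∀ i, M i ≃ₗ[R] ↥(C i ⊓ F i)) :
    Function.Bijective
      (LinearMap.lsum R M R fun i => (C i ⊓ F i : Submodule R H).subtype ∘ₗ (ψ i).toLinearMap) := by
  have hanti : Antitone F := antitone_nat_of_succ_le hF
  constructor
  · refine (injective_iff_map_eq_zero _).2 fun x hx => ?_
    -- Once the components below k vanish, the k-th one is minus a sum of terms in F (k + 1); it
    -- also lies in C k, hence is zero.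
    have key : ∀ k : ℕ, ∀ hk : k < n, x ⟨k, hk⟩ = 0 := by
      intro k
      induction k using Nat.strong_induction_on with
      | _ k ih =>
        intro hk
        have hs : (ψ ⟨k, hk⟩ (x ⟨k, hk⟩) : H) =
            -∑ j ∈ Finset.univ.erase (⟨k, hk⟩ : Fin n), (ψ j (x j) : H) := by
          rw [eq_neg_iff_add_eq_zero, Finset.add_sum_erase _ (fun j => (ψ j (x j) : H))
            (Finset.mem_univ _)]
          simpa [LinearMap.lsum_apply] using hx
        have hm : (ψ ⟨k, hk⟩ (x ⟨k, hk⟩) : H) ∈ C k ⊓ F (k + 1) := by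
          refine ⟨(ψ ⟨k, hk⟩ (x ⟨k, hk⟩)).2.1, ?_⟩
          change (ψ ⟨k, hk⟩ (x ⟨k, hk⟩) : H) ∈ F (k + 1)
          rw [hs]
          refine neg_mem (Submodule.sum_mem _ fun j hj => ?_)
          obtain hjk | hjk := lt_or_gt_of_ne (fun h => Finset.ne_of_mem_erase hj (Fin.ext h) :
            (j : ℕ) ≠ k)
          · rw [ih j hjk j.2, map_zero]; exact zero_mem _
          · exact hanti hjk (ψ j (x j)).2.2
        rw [(hC k).inf_eq_bot, Submodule.mem_bot] at hm
        exact (ψ ⟨k, hk⟩).map_eq_zero_iff.1 (Subtype.ext hm)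
    exact funext fun i => key i i.2
  · rw [← LinearMap.range_eq_top, eq_top_iff, ← h0]
    -- Descending induction on i, with k = n - i: the C i-component of an element of F i again lies
    -- in F i, and the rest lies in F (i + 1).
    have key : ∀ k i, i + k = n → F i ≤ LinearMap.range (LinearMap.lsum R M R fun i =>
        (C i ⊓ F i : Submodule R H).subtype ∘ₗ (ψ i).toLinearMap) := by
      intro k
      induction k with
      | zero => rintro i rfl; simp at hn; rw [hn]; exact bot_le
      | succ k ih =>
        intro i hi x hx
        have hx' : x ∈ C i ⊔ F (i + 1) := by rw [(hC i).sup_eq_top]; trivial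
        obtain ⟨c, hc, h, hh, rfl⟩ := Submodule.mem_sup.1 hx'
        refine add_mem ?_ (ih (i + 1) (by omega) hh)
        have hcF : c ∈ F i := by simpa using sub_mem hx (hF i hh)
        let i' : Fin n := ⟨i, by omega⟩
        refine ⟨Pi.single i' ((ψ i').symm ⟨c, hc, hcF⟩), ?_⟩
        refine (LinearMap.lsum_piSingle ..).trans ?_
        simp
    exact key n 0 (by omega)

end LinearAlgebra

/-! ### Complexes with acyclic boundaries: opposite filtrations and degeneration. -/

section Acyclic
variable {𝒜 : Type u} [Category.{v} 𝒜] [Abelian 𝒜] [HasDerivedCategory.{w} 𝒜] (R : Type t)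
  [CommRing R] [Linear R 𝒜] (I : 𝒜)

/-- `H^m(F[-i]) → H^{m-i}(F)`. -/
noncomputable def hyperHSingle (F : 𝒜) (i m : ℤ) :
    HyperH R I ((CochainComplex.singleFunctor 𝒜 i).obj F) m →ₗ[R] SheafH R I F (m - i) :=
  Linear.rightComp R ((DerivedCategory.singleFunctor 𝒜 0).obj I) (shiftIso F m i).hom

theorem hyperHSingle_bijective (F : 𝒜) (i m : ℤ) : Function.Bijective (hyperHSingle R I F i m) :=
  ((shiftIso F m i).homToEquiv (Z := (DerivedCategory.singleFunctor 𝒜 0).obj I)).bijective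

theorem hodgeGr_apply (K : CochainComplex 𝒜 ℤ) (i m : ℤ) (x : HyperH R I (stupidGE K i) m) :
    hodgeGr R I K i m x =
      hyperHSingle R I (K.X i) i m (hyperHMap R I (stupidGEToSingle K i) m x) := rfl

theorem hodgeGr_eq_zero_iff (K : CochainComplex 𝒜 ℤ) (i m : ℤ) (x : HyperH R I (stupidGE K i) m) :
    hodgeGr R I K i m x = 0 ↔ ∃ y, hyperHMap R I (stupidGESucc K i) m y = x := by
  rw [hodgeGr_apply, map_eq_zero_iff _ (hyperHSingle_bijective R I _ i m).1]
  exact hyperHMap_exact R I (stupidGESuccSC_shortExact K i) m x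

theorem hyperHMap_stupidGEι_succ (K : CochainComplex 𝒜 ℤ) (i m : ℤ)
    (y : HyperH R I (stupidGE K (i + 1)) m) :
    hyperHMap R I (stupidGEι K i) m (hyperHMap R I (stupidGESucc K i) m y) =
      hyperHMap R I (stupidGEι K (i + 1)) m y := by
  rw [← hyperHMap_comp, stupidGESucc_comp_ι]

theorem filHodge_succ_le (K : CochainComplex 𝒜 ℤ) (i m : ℤ) :
    filHodge R I K (i + 1) m ≤ filHodge R I K i m := by
  rintro _ ⟨y, rfl⟩
  exact ⟨_, hyperHMap_stupidGEι_succ R I K i m y⟩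

theorem filHodge_eq_top (K : CochainComplex 𝒜 ℤ) (i m : ℤ) [K.IsStrictlyGE i] :
    filHodge R I K i m = ⊤ := by
  have := isIso_stupidGEι K i
  exact LinearMap.range_eq_top.2 (hyperHMap_bijective_of_isIso R I (stupidGEι K i) m).2

theorem filHodge_eq_bot (K : CochainComplex 𝒜 ℤ) {i m : ℤ} (h : m < i) :
    filHodge R I K i m = ⊥ := by
  have := hyperH_subsingleton_of_isStrictlyGE R I (stupidGE K i) i m h
  rw [eq_bot_iff]
  rintro _ ⟨y, rfl⟩
  rw [Subsingleton.elim y 0, map_zero]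
  exact zero_mem _

/-- The complex `L` has acyclic boundaries `Lⁱ / ker d`. -/
def BoundariesAcyclic (L : CochainComplex 𝒜 ℤ) : Prop :=
  ∀ i m : ℤ, Subsingleton (HyperH R I (stupidGEQuotSC L i).X₃ m)

/-- The complex in question is L^i / ker d = K^i / Z_N K^i placed in degree i, and the long exact
sequence turns the bijectivity for Z_N into vanishing. -/
theorem boundariesAcyclic_cplxMod (K : CochainComplex 𝒜 ℤ) (N : ℕ)
    (hZ : ∀ i j : ℤ, Function.Bijective (sheafHMap R I (closedModι K N i) j)) :
    BoundariesAcyclic R I (cplxMod K N) := by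
  intro i m
  obtain ⟨e⟩ := stupidGEQuot_iso_single (cplxMod K N) i
  have h : Subsingleton (SheafH R I ((quotTruncLE (cplxMod K N) i).X i) (m - i)) :=
    right_acyclic_of_bijective R I (single_shortExact (closedModSC_shortExact K N i) 0)
      (fun j => hZ i j) (m - i)
  have h2 : Function.Injective (hyperHSingle R I ((quotTruncLE (cplxMod K N) i).X i) i m) :=
    (hyperHSingle_bijective R I _ i m).1
  have h3 := (hyperHMap_bijective_of_isIso R I e.hom m).1
  exact (h2.comp h3).subsingleton

variable {R I} {L : CochainComplex 𝒜 ℤ}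
namespace BoundariesAcyclic
variable (hL : BoundariesAcyclic R I L)
include hL

theorem bijective_stupidGEToQuot (i m : ℤ) :
    Function.Bijective (hyperHMap R I (stupidGEToQuot L i) m) :=
  hyperHMap_bijective_of_right_acyclic R I (stupidGEQuotSC_shortExact L i) (hL i) m

/-- Followed by the projection to L / t_{≤ i-1} L, the map becomes bijective. -/
theorem injective_stupidGEι (i m : ℤ) : Function.Injective (hyperHMap R I (stupidGEι L i) m) := by
  obtain ⟨i, rfl⟩ : ∃ j, j + 1 = i := ⟨i - 1, by omega⟩
  intro x y h
  refine (hL.bijective_stupidGEToQuot i m).1 ?_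
  rw [hyperHMap_comp, hyperHMap_comp, h]

/-- The conjugate step is the kernel of H(L) → H(L / t_{≤ i} L), and the Hodge step i + 1 maps
isomorphically onto the target. -/
theorem isCompl (i m : ℤ) : IsCompl (filCon R I L i m) (filHodge R I L (i + 1) m) := by
  have hb := hL.bijective_stupidGEToQuot i m
  have hc : ∀ x, x ∈ filCon R I L i m ↔ hyperHMap R I (quotTruncLEπ L i) m x = 0 := fun x =>
    (hyperHMap_exact R I (L.shortComplexTruncLE_shortExact i) m x).symm
  constructor
  · rw [Submodule.disjoint_def]
    rintro _ hx ⟨y, rfl⟩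
    rw [hc, ← hyperHMap_comp] at hx
    rw [(map_eq_zero_iff _ hb.1).1 hx, map_zero]
  · rw [codisjoint_iff, eq_top_iff]
    intro x _
    obtain ⟨y, hy⟩ := hb.2 (hyperHMap R I (quotTruncLEπ L i) m x)
    rw [hyperHMap_comp] at hy
    refine Submodule.mem_sup.2 ⟨x - hyperHMap R I (stupidGEι L (i + 1)) m y, ?_, _, ⟨y, rfl⟩,
      sub_add_cancel _ _⟩
    rw [hc, map_sub, hy, sub_self]

/-- The obstruction is the kernel of H(L^{• ≥ i+1}) → H(L^{• ≥ i}) in degree m + 1, which is zero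
because even the composite into H(L) is injective. -/
theorem surjective_hodgeGr (i m : ℤ) : Function.Surjective (hodgeGr R I L i m) := by
  refine (hyperHSingle_bijective R I (L.X i) i m).2.comp
    ((hyperHMap_surjective_iff_injective R I (stupidGESuccSC_shortExact L i) m (m + 1) rfl).2 ?_)
  refine Function.Injective.of_comp (f := hyperHMap R I (stupidGEι L i) (m + 1)) ?_
  convert! hL.injective_stupidGEι (i + 1) (m + 1) using 1
  exact funext fun y => hyperHMap_stupidGEι_succ R I L i (m + 1) y

theorem exists_linearEquiv (i m : ℤ) :
    ∃ e : ↥(filCon R I L i m ⊓ filHodge R I L i m) ≃ₗ[R] SheafH R I (L.X i) (m - i),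
      ∀ y hy, e ⟨hyperHMap R I (stupidGEι L i) m y, hy⟩ = hodgeGr R I L i m y := by
  refine exists_linearEquiv_inf_range _ _ (hL.injective_stupidGEι i m) (hL.surjective_hodgeGr i m)
    (filCon R I L i m) ?_
  convert! hL.isCompl i m using 1
  ext x
  constructor
  · rintro ⟨y, hy, rfl⟩
    obtain ⟨z, rfl⟩ := (hodgeGr_eq_zero_iff R I L i m y).1 hy
    exact ⟨z, (hyperHMap_stupidGEι_succ R I L i m z).symm⟩
  · rintro ⟨z, rfl⟩
    exact ⟨_, (hodgeGr_eq_zero_iff R I L i m _).2 ⟨z, rfl⟩, hyperHMap_stupidGEι_succ R I L i m z⟩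

end BoundariesAcyclic
end Acyclic

/-! ### Torsion and divisibility by N in the hypercohomology of stupid truncations. -/

section ModN
variable {𝒜 : Type u} [Category.{v} 𝒜] [Abelian 𝒜] [HasDerivedCategory.{w} 𝒜] (R : Type t)
  [CommRing R] [Linear R 𝒜] (I : 𝒜)

section
variable {P Q : CochainComplex 𝒜 ℤ} {φ : P ⟶ Q} {N : ℕ} {h0 : (N • 𝟙 P) ≫ φ = 0}
  (hS : (ShortComplex.mk _ _ h0).ShortExact)
include hS

theorem hyperHMap_eq_zero_iff_of_nsmul (m : ℤ) (x : HyperH R I P m) :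
    hyperHMap R I φ m x = 0 ↔ ∃ y, (N : R) • y = x := by
  refine (hyperHMap_exact R I hS m x).trans (exists_congr fun y => ?_)
  rw [← hyperHMap_id R I P m y, ← hyperHMap_nsmul, hyperHMap_id]

theorem hyperHMap_surjective_of_nsmul {m : ℤ}
    (h : ∀ x : HyperH R I P (m + 1), (N : R) • x = 0 → x = 0) :
    Function.Surjective (hyperHMap R I φ m) := by
  refine (hyperHMap_surjective_iff_injective R I hS m (m + 1) rfl).2 ?_
  refine (injective_iff_map_eq_zero _).2 fun x hx => h x ?_
  rwa [← hyperHMap_id R I P (m + 1) x, ← hyperHMap_nsmul]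

/-- The cokernel of the map is the N-torsion in degree m + 1, whence the shift in the hypothesis. -/
theorem hyperHModMap_bijective (hφ : N • φ = 0) {m : ℤ}
    (h : ∀ x : HyperH R I P (m + 1), (N : R) • x = 0 → x = 0) :
    Function.Bijective (hyperHModMap R I φ N hφ m) := by
  refine ⟨LinearMap.ker_eq_bot.1 ?_, fun y => ?_⟩
  · refine Submodule.ker_liftQ_eq_bot _ _ _ fun x hx => ?_
    exact (hyperHMap_eq_zero_iff_of_nsmul R I hS m x).1 hx
  · obtain ⟨x, rfl⟩ := hyperHMap_surjective_of_nsmul R I hS h y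
    exact ⟨Submodule.Quotient.mk x, rfl⟩

end

theorem hyperHMap_stupidGEι_cplxModπ (K : CochainComplex 𝒜 ℤ) (N : ℕ) (i m : ℤ)
    (x : HyperH R I (stupidGE K i) m) :
    hyperHMap R I (stupidGEι (cplxMod K N) i) m
        (hyperHMap R I (stupidGEMap (cplxModπ K N) i) m x) =
      hyperHMap R I (cplxModπ K N) m (hyperHMap R I (stupidGEι K i) m x) := by
  rw [← hyperHMap_comp, ← hyperHMap_comp, stupidGEMap_comp_ι]

variable {R I} {K : CochainComplex 𝒜 ℤ} {N : ℕ} (hK : ∀ i, Mono (N • 𝟙 (K.X i)))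
  (hL : BoundariesAcyclic R I (cplxMod K N))
  (hDR : ∀ (m : ℤ) (x : HyperH R I K m), (N : R) • x = 0 → x = 0)
include hK hL hDR

/-- The reduction of x dies in H(L), hence already in H(L^{• ≥ j}), so x = Ny. Since H(K) has no
N-torsion, y lies in the kernel too, and the division can be iterated. -/
theorem exists_smul_eq_of_stupidGEι_eq_zero (j n : ℤ) (x : HyperH R I (stupidGE K j) n)
    (hx : hyperHMap R I (stupidGEι K j) n x = 0) :
    ∃ y : HyperH R I (stupidGE K j) n,
      (N : R) • y = x ∧ hyperHMap R I (stupidGEι K j) n y = 0 := by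
  obtain ⟨y, rfl⟩ := (hyperHMap_eq_zero_iff_of_nsmul R I (nsmul_stupidGE_shortExact K N hK j
    (nsmul_id_comp_eq_zero (nsmul_stupidGEMap K N j))) n x).1 (hL.injective_stupidGEι j n (by
      rw [hyperHMap_stupidGEι_cplxModπ, hx, map_zero, map_zero]))
  refine ⟨y, rfl, hDR n _ ?_⟩
  rwa [map_smul] at hx

theorem exists_pow_smul_eq_of_stupidGEι_eq_zero (j n : ℤ) (k : ℕ)
    (x : HyperH R I (stupidGE K j) n) (hx : hyperHMap R I (stupidGEι K j) n x = 0) :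
    ∃ y : HyperH R I (stupidGE K j) n, (N : R) ^ k • y = x := by
  induction k generalizing x with
  | zero => exact ⟨x, by rw [pow_zero, one_smul]⟩
  | succ k ih =>
    obtain ⟨y, rfl, hy⟩ := exists_smul_eq_of_stupidGEι_eq_zero hK hL hDR j n x hx
    obtain ⟨z, rfl⟩ := ih y hy
    exact ⟨z, by rw [pow_succ', mul_smul]⟩

/-- This is the injectivity of Fil^i / N → H(K) / N. If y lifts Nx, its reduction dies in H(L),
hence in H(L^{• ≥ i}), so y = Nz; then x and the image of z differ by N-torsion of H(K). -/
theorem mem_filHodge_of_smul_mem (i m : ℤ) (x : HyperH R I K m)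
    (hx : (N : R) • x ∈ filHodge R I K i m) : x ∈ filHodge R I K i m := by
  obtain ⟨y, hy⟩ := hx
  obtain ⟨z, rfl⟩ := (hyperHMap_eq_zero_iff_of_nsmul R I (nsmul_stupidGE_shortExact K N hK i
    (nsmul_id_comp_eq_zero (nsmul_stupidGEMap K N i))) m y).1 (hL.injective_stupidGEι i m (by
      rw [hyperHMap_stupidGEι_cplxModπ, hy, map_smul, ← hyperHMap_nsmul, nsmul_cplxModπ,
        hyperHMap_zero, map_zero]))
  refine ⟨z, (sub_eq_zero.1 (hDR m _ ?_)).symm⟩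
  rw [smul_sub, ← hy, map_smul, sub_self]

variable [IsNoetherianRing R] [hHodge : ∀ i j, Module.Free R (SheafH R I (K.X i) j)]
include hHodge

/-- The image of x in the free module H(K^j) is divisible by all powers of N, so by Krull some 1 -
aN kills it. Then aNx - x comes from the kernel for j + 1, and the induction goes on until j exceeds
n, where hypercohomology vanishes; k bounds the number of steps. -/
theorem exists_mul_smul_eq_of_stupidGEι_eq_zero (n : ℤ) (k : ℕ) (j : ℤ) (hj : n < j + k)
    (x : HyperH R I (stupidGE K j) n) (hx : hyperHMap R I (stupidGEι K j) n x = 0) :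
    ∃ a : R, (a * N) • x = x := by
  induction k generalizing j with
  | zero =>
    have := hyperH_subsingleton_of_isStrictlyGE R I (stupidGE K j) j n (by simpa using hj)
    exact ⟨0, Subsingleton.elim _ _⟩
  | succ k ih =>
    obtain ⟨a, ha⟩ := exists_smul_eq_of_forall_pow_smul (N : R) (hodgeGr R I K j n x) fun l => by
      obtain ⟨y, rfl⟩ := exists_pow_smul_eq_of_stupidGEι_eq_zero hK hL hDR j n l x hx
      exact ⟨_, (map_smul _ _ _).symm⟩
    obtain ⟨z, hz⟩ := (hodgeGr_eq_zero_iff R I K j n ((a * N) • x - x)).1 (by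
      rw [map_sub, map_smul, ha, sub_self])
    obtain ⟨c, hc⟩ := ih (j + 1) (by push_cast at hj; omega) z (by
      rw [← hyperHMap_stupidGEι_succ, hz, map_sub, map_smul, hx, smul_zero, sub_self])
    replace hc := congrArg (hyperHMap R I (stupidGESucc K j) n) hc
    rw [map_smul, hz] at hc
    -- The witness comes from (1 - cN)(1 - aN) = 1 - (a + c - cNa)N.
    refine ⟨a + c - c * N * a, ?_⟩
    rw [← sub_eq_zero] at hc ⊢
    rw [← neg_eq_zero, ← hc]
    module

theorem eq_zero_of_smul_stupidGE_eq_zero (j n : ℤ) (x : HyperH R I (stupidGE K j) n)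
    (hx : (N : R) • x = 0) : x = 0 := by
  obtain ⟨a, ha⟩ := exists_mul_smul_eq_of_stupidGEι_eq_zero hK hL hDR n (n - j + 1).toNat j
    (by omega) x (hDR n _ (by rw [← map_smul, hx, map_zero]))
  rw [← ha, mul_smul, hx, smul_zero]

/-- Absence of N-torsion in degree m + 1 makes H(K^{• ≥ i}) → H(L^{• ≥ i}) surjective in degree m;
the rest is naturality. -/
theorem filHodge_cplxMod (i m : ℤ) : filHodge R I (cplxMod K N) i m =
    (filHodge R I K i m).map (hyperHMap R I (cplxModπ K N) m) := by
  have hs := hyperHMap_surjective_of_nsmul R I (nsmul_stupidGE_shortExact K N hK i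
    (nsmul_id_comp_eq_zero (nsmul_stupidGEMap K N i)))
    (eq_zero_of_smul_stupidGE_eq_zero hK hL hDR i (m + 1))
  ext x
  constructor
  · rintro ⟨y, rfl⟩
    obtain ⟨z, rfl⟩ := hs y
    exact ⟨_, ⟨z, rfl⟩, (hyperHMap_stupidGEι_cplxModπ R I K N i m z).symm⟩
  · rintro ⟨_, ⟨z, rfl⟩, rfl⟩
    exact ⟨_, hyperHMap_stupidGEι_cplxModπ R I K N i m z⟩

end ModN

/-! ### The decomposition theorem for abstract complexes. -/

section Decomposition
variable {𝒜 : Type u} [Category.{v} 𝒜] [Abelian 𝒜] [HasDerivedCategory.{w} 𝒜] {R : Type t}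
  [CommRing R] [IsNoetherianRing R] [Linear R 𝒜] {I : 𝒜}

theorem _root_.Module.Free.eq_zero_of_smul_eq_zero {R M : Type*} [CommRing R] [AddCommGroup M]
    [Module R M] [Module.Free R M] {a : R} (ha : ∀ b, a * b = 0 → b = 0) {x : M}
    (hx : a • x = 0) : x = 0 := by
  let B := Module.Free.chooseBasis R M
  refine B.repr.injective (Finsupp.ext fun i => ?_)
  rw [map_zero]
  refine ha _ ?_
  rw [← smul_eq_mul, ← Finsupp.smul_apply, ← map_smul, hx, map_zero]
  rfl

/-- The Hodge decomposition modulo `N`, for a complex of torsion free objects in an abelian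
category. -/
theorem hodge_decomposition_mod (K : CochainComplex 𝒜 ℤ) [K.IsStrictlyGE 0] (N : ℕ)
    (hK : ∀ i, Mono (N • 𝟙 (K.X i))) (hN : ∀ b : R, (N : R) * b = 0 → b = 0)
    (hDR : ∀ m : ℤ, Module.Free R (HyperH R I K m))
    (hHodge : ∀ i j : ℤ, Module.Free R (SheafH R I (K.X i) j))
    (hZ : ∀ i j : ℤ, Function.Bijective (sheafHMap R I (closedModι K N i) j)) (m : ℕ) :
    Function.Bijective (hyperHModMap R I (cplxModπ K N) N (nsmul_cplxModπ K N) m) ∧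
    (∀ i : ℤ, Function.Bijective (hyperHModMap R I _ N (nsmul_single K N i) (m - i))) ∧
    (∀ i : ℤ, filHodge R I (cplxMod K N) i m =
      (filHodge R I K i m).map (hyperHMap R I (cplxModπ K N) m)) ∧
    (∀ (i : ℤ) (x : HyperH R I K m), (N : R) • x ∈ filHodge R I K i m → x ∈ filHodge R I K i m) ∧
    (∀ i : ℤ, IsCompl (filCon R I (cplxMod K N) i m) (filHodge R I (cplxMod K N) (i + 1) m)) ∧
    ∃ e : ∀ i : ℤ, ↥(filCon R I (cplxMod K N) i m ⊓ filHodge R I (cplxMod K N) i m) ≃ₗ[R]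
        ModBy R (SheafH R I (K.X i) (m - i)) N,
      (∀ (i : ℤ) (y) (hy : hyperHMap R I (stupidGEι (cplxMod K N) i) m y ∈
          filCon R I (cplxMod K N) i m ⊓ filHodge R I (cplxMod K N) i m),
        hyperHModMap R I _ N (nsmul_single K N i) (m - i)
          (e i ⟨hyperHMap R I (stupidGEι (cplxMod K N) i) m y, hy⟩) =
            hodgeGr R I (cplxMod K N) i m y) ∧
      ∃ Φ : (DirectSum (Fin (m + 1)) fun i =>
          ModBy R (SheafH R I (K.X (i : ℕ)) (m - (i : ℕ))) N) ≃ₗ[R] ModBy R (HyperH R I K m) N,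
        ∀ (i : Fin (m + 1)) (x : ModBy R (SheafH R I (K.X (i : ℕ)) (m - (i : ℕ))) N),
          hyperHModMap R I (cplxModπ K N) N (nsmul_cplxModπ K N) m
            (Φ (DirectSum.lof R (Fin (m + 1))
            (fun i => ModBy R (SheafH R I (K.X (i : ℕ)) (m - (i : ℕ))) N) i x)) =
            ((e (i : ℕ)).symm x : HyperH R I (cplxMod K N) m) := by
  have hL := boundariesAcyclic_cplxMod R I K N hZ
  have hDR' : ∀ (m : ℤ) (x : HyperH R I K m), (N : R) • x = 0 → x = 0 := fun m x hx =>
    Module.Free.eq_zero_of_smul_eq_zero hN hx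
  have h1 : Function.Bijective (hyperHModMap R I (cplxModπ K N) N (nsmul_cplxModπ K N) m) :=
    hyperHModMap_bijective R I (cplxModSC_shortExact K N hK) _ (hDR' _)
  have h2 : ∀ i : ℤ, Function.Bijective (hyperHModMap R I _ N (nsmul_single K N i) (m - i)) :=
    fun i => hyperHModMap_bijective R I (nsmul_single_shortExact K N i (hK i)
      (nsmul_id_comp_eq_zero (nsmul_single K N i))) _ fun x hx =>
        Module.Free.eq_zero_of_smul_eq_zero hN hx
  have : (cplxMod K N).IsStrictlyGE 0 := by
    rw [CochainComplex.isStrictlyGE_iff]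
    exact fun j hj => (K.isZero_of_isStrictlyGE 0 j hj).of_epi ((cplxModπ K N).f j)
  choose e he using fun i : ℤ => hL.exists_linearEquiv i m
  -- The graded piece H(L^i) is replaced by H(K^i) / N through the comparison isomorphism.
  let e' := fun i : ℤ => (e i).trans (LinearEquiv.ofBijective _ (h2 i)).symm
  -- The Hodge filtration in degree m starts at 0 and is zero from step m + 1 on, so the summands
  -- are indexed by 0, …, m.
  have h4 := bijective_lsum_of_isCompl (n := m + 1) (fun i => filHodge R I (cplxMod K N) i m)
    (fun i => filCon R I (cplxMod K N) i m) (filHodge_eq_top R I _ 0 m)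
    (filHodge_eq_bot R I _ (by push_cast; omega)) (fun i => filHodge_succ_le R I _ i m)
    (fun i => hL.isCompl i m) (fun i : Fin (m + 1) => (e' (i : ℕ)).symm)
  refine ⟨h1, h2, fun i => filHodge_cplxMod hK hL hDR' i m,
    fun i x => mem_filHodge_of_smul_mem hK hL hDR' i m x, fun i => hL.isCompl i m, e',
    fun i y hy => ?_, (DirectSum.linearEquivFunOnFintype R _ _).trans
      ((LinearEquiv.ofBijective _ h4).trans (LinearEquiv.ofBijective _ h1).symm), fun i x => ?_⟩
  · rw [← he i y hy]
    exact (LinearEquiv.ofBijective _ (h2 i)).apply_symm_apply _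
  · refine ((LinearEquiv.ofBijective _ h1).apply_symm_apply _).trans ?_
    exact (congrArg (LinearEquiv.ofBijective _ h4)
      (DirectSum.linearEquivFunOnFintype_lof ..)).trans (LinearMap.lsum_piSingle (S := R) ..)

end Decomposition

/-! ### Injectivity of N on the sheaves of differential forms. -/

section TorsionFree

theorem eq_zero_of_nsmul_eq_zero_of_flat {M : Type*} [AddCommGroup M] [Module.Flat ℤ M] {N : ℕ}
    (hN : 0 < N) {x : M} (hx : N • x = 0) : x = 0 := by
  have : Module.IsTorsionFree ℤ M := inferInstance
  rw [← Nat.cast_smul_eq_nsmul ℤ] at hx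
  exact (smul_eq_zero.1 hx).resolve_left (by exact_mod_cast hN.ne')

/-- A projective module is a retract of a free one, so its exterior power embeds in a free B-module,
which is flat over ℤ. -/
theorem eq_zero_of_nsmul_exteriorPower {B M : Type*} [CommRing B] [Module.Flat ℤ B]
    [AddCommGroup M] [Module B M] [Module.Projective B M] {N : ℕ} (hN : 0 < N) (n : ℕ)
    {x : ⋀[B]^n M} (hx : N • x = 0) : x = 0 := by
  obtain ⟨s, hs⟩ := Module.projective_def'.1 (inferInstance : Module.Projective B M)
  have : Module.Flat ℤ (⋀[B]^n (M →₀ B)) := Module.Flat.trans ℤ B _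
  refine exteriorPower.map_injective (n := n) _ hs ?_
  rw [map_zero]
  exact eq_zero_of_nsmul_eq_zero_of_flat hN (by rw [← map_nsmul, hx, map_zero])

variable {A : Type u} [CommRing A] {X : Scheme.{u}} (f : X ⟶ Spec (CommRingCat.of A))

theorem structMap_smooth [Smooth f] {V : X.Opens} (hV : IsAffineOpen V) :
    (structMap f V).Smooth :=
  RingHom.Smooth.comp (RingHom.Smooth.of_bijective
    ((ConcreteCategory.bijective_of_isIso (Scheme.ΓSpecIso (CommRingCat.of A)).inv)))
    (f.smooth_appLE (isAffineOpen_top _) hV le_top)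

theorem eq_zero_of_nsmul_forms [Smooth f] [Module.Flat ℤ A] {N : ℕ} (hN : 0 < N) (n : ℕ)
    {V : X.Opens} (hV : IsAffineOpen V) {x : (formsFunctor A n).obj (sectionsObj f V)}
    (hx : N • x = 0) : x = 0 := by
  have h : Algebra.Smooth A (sectionsObj f V) := structMap_smooth f hV
  have : Module.Flat ℤ (sectionsObj f V) := Module.Flat.trans ℤ A _
  exact eq_zero_of_nsmul_exteriorPower hN n hx

/-- On affine opens the sections form a smooth A-algebra, whose differentials are projective. Affine
opens form a basis, and local injectivity is all that sheafification needs. -/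
theorem isLocallyInjective_nsmul_forms [Smooth f] [Module.Flat ℤ A] {N : ℕ} (hN : 0 < N) (n : ℕ) :
    Presheaf.IsLocallyInjective (Opens.grothendieckTopology X)
      (N • 𝟙 (sectionsAlg f ⋙ formsFunctor A n)) where
  equalizerSieve_mem {U} x y h p hp := by
    obtain ⟨V, hV, hpV, hVU⟩ := exists_isAffineOpen_mem_and_subset (U := U.unop) hp
    refine ⟨V, homOfLE hVU, ?_, hpV⟩
    let ρ : (formsFunctor A n).obj (sectionsObj f U.unop) →ₗ[A]
      (formsFunctor A n).obj (sectionsObj f V) :=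
      ((sectionsAlg f ⋙ formsFunctor A n).map (homOfLE hVU : V ⟶ U.unop).op).hom
    have h' : N • x = N • y := h
    refine sub_eq_zero.1 ((map_sub ρ x y).symm.trans (eq_zero_of_nsmul_forms f hN n hV ?_))
    refine (map_nsmul ρ N (x - y)).symm.trans ?_
    rw [nsmul_sub, h', sub_self]
    exact map_zero ρ

theorem mono_nsmul_Omega [Smooth f] [Module.Flat ℤ A] {N : ℕ} (hN : 0 < N) (i : ℤ) :
    Mono (N • 𝟙 (Omega f i)) := by
  match i with
  | .negSucc n => exact (isZero_zero _).mono _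
  | .ofNat n =>
    have h1 := isLocallyInjective_nsmul_forms f hN n
    have h2 : Sheaf.IsLocallyInjective ((presheafToSheaf (Opens.grothendieckTopology X)
      (ModuleCat.{u} A)).map (N • 𝟙 (sectionsAlg f ⋙ formsFunctor A n))) :=
      (Presheaf.isLocallyInjective_presheafToSheaf_map_iff _ _).2 h1
    have h3 : Mono ((presheafToSheaf (Opens.grothendieckTopology X)
      (ModuleCat.{u} A)).map (N • 𝟙 (sectionsAlg f ⋙ formsFunctor A n))) :=
      Sheaf.mono_of_isLocallyInjective _
    have h4 : N • 𝟙 (Omega f (.ofNat n)) =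
        (sheafification A X).map (N • 𝟙 (sectionsAlg f ⋙ formsFunctor A n)) := by
      rw [Functor.map_nsmul, CategoryTheory.Functor.map_id]
      rfl
    rw [h4]
    exact h3

end TorsionFree

/-! ### Extension of the hypotheses from natural to integer indices, by vanishing in negative
degrees. -/

section Vanishing
variable {A : Type u} [CommRing A] {X : Scheme.{u}} (f : X ⟶ Spec (CommRingCat.of A))

theorem isZero_deRham_X {i : ℤ} (hi : i < 0) : IsZero ((deRham f).X i) := by
  obtain ⟨n, rfl⟩ := Int.eq_negSucc_of_lt_zero hi
  exact isZero_zero _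

instance : (deRham f).IsStrictlyGE 0 := by
  rw [CochainComplex.isStrictlyGE_iff]
  exact fun i hi => isZero_deRham_X f hi

theorem sheafH_subsingleton_of_neg {𝒜 : Type u} [Category.{v} 𝒜] [Abelian 𝒜]
    [HasDerivedCategory.{w} 𝒜] (R : Type t) [CommRing R] [Linear R 𝒜] (I F : 𝒜) {j : ℤ}
    (hj : j < 0) : Subsingleton (SheafH R I F j) :=
  hyperH_subsingleton_of_isStrictlyGE R I _ 0 j hj

theorem sheafH_subsingleton_of_isZero {𝒜 : Type u} [Category.{v} 𝒜] [Abelian 𝒜]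
    [HasDerivedCategory.{w} 𝒜] (R : Type t) [CommRing R] [Linear R 𝒜] (I : 𝒜) {F : 𝒜}
    (hF : IsZero F) (j : ℤ) : Subsingleton (SheafH R I F j) :=
  hyperH_subsingleton_of_isZero R I _ ((CochainComplex.singleFunctor 𝒜 0).map_isZero hF) j

theorem free_HDR (h : ∀ m : ℕ, Module.Free A (HDR f m)) (m : ℤ) : Module.Free A (HDR f m) := by
  obtain hm | hm := lt_or_ge m 0
  · have := hyperH_subsingleton_of_isStrictlyGE A (unitSheaf A X) (deRham f) 0 m hm
    exact Module.Free.of_subsingleton _ _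
  · lift m to ℕ using hm
    exact h m

theorem subsingleton_HHodge {i j : ℤ} (h : i < 0 ∨ j < 0) : Subsingleton (HHodge f i j) := by
  obtain h | h := h
  · exact sheafH_subsingleton_of_isZero A _ (isZero_deRham_X f h) j
  · exact sheafH_subsingleton_of_neg A _ _ h

theorem free_HHodge (h : ∀ i j : ℕ, Module.Free A (HHodge f i j)) (i j : ℤ) :
    Module.Free A (HHodge f i j) := by
  by_cases hij : i < 0 ∨ j < 0
  · have := subsingleton_HHodge f hij
    exact Module.Free.of_subsingleton _ _
  · push Not at hij
    obtain ⟨hi, hj⟩ := hij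
    lift i to ℕ using hi
    lift j to ℕ using hj
    exact h i j

theorem bijective_closedModCohMap (N : ℕ)
    (h : ∀ i j : ℕ, Function.Bijective (closedModCohMap f N i j)) (i j : ℤ) :
    Function.Bijective (closedModCohMap f N i j) := by
  by_cases hij : i < 0 ∨ j < 0
  · have h1 := subsingleton_HHodge f hij
    have h2 : Subsingleton (XSheafH A X (closedMod (deRham f) N i) j) := by
      obtain h | h := hij
      · exact sheafH_subsingleton_of_isZero A _
          ((isZero_deRham_X f h).of_mono (closedModι (deRham f) N i)) j
      · exact sheafH_subsingleton_of_neg A _ _ h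
    exact ⟨fun x y _ => Subsingleton.elim x y, fun y => ⟨0, Subsingleton.elim _ _⟩⟩
  · push Not at hij
    obtain ⟨hi, hj⟩ := hij
    lift i to ℕ using hi
    lift j to ℕ using hj
    exact h i j

end Vanishing

end DeRhamMod

theorem theorem1 {A : Type u} [CommRing A] (r : ℕ) [Algebra (MvPolynomial (Fin r) ℤ) A]
    [Algebra.Etale (MvPolynomial (Fin r) ℤ) A] {X : Scheme.{u}}
    (f : X ⟶ Spec (CommRingCat.of A)) [Smooth f] (hf : IsProjective f)
    (hDR : ∀ m : ℕ, Module.Free A (HDR f m))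
    (hHodge : ∀ i j : ℕ, Module.Free A (HHodge f i j))
    (N : ℕ) (hN : 0 < N)
    (hZ : ∀ i j : ℕ, Function.Bijective (closedModCohMap f N i j)) (m : ℕ) :
    Function.Bijective (compDR f N m) ∧
    (∀ i : ℤ, Function.Bijective (compHodge f N i (m - i))) ∧
    (∀ i : ℤ, FilHodgeMod f N i m = (FilHodgeDR f i m).map (redDR f N m)) ∧
    (∀ (i : ℤ) (x : HDR f m), (N : A) • x ∈ FilHodgeDR f i m → x ∈ FilHodgeDR f i m) ∧
    (∀ i : ℤ, IsCompl (FilConMod f N i m) (FilHodgeMod f N (i + 1) m)) ∧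
    ∃ e : ∀ i : ℤ, ↥(FilConMod f N i m ⊓ FilHodgeMod f N i m) ≃ₗ[A]
        ModBy A (HHodge f i (m - i)) N,
      (∀ (i : ℤ) (y) (hy : fromHodgeMod f N i m y ∈ FilConMod f N i m ⊓ FilHodgeMod f N i m),
        compHodge f N i (m - i) (e i ⟨fromHodgeMod f N i m y, hy⟩) = hodgeGrMod f N i m y) ∧
      ∃ Φ : (DirectSum (Fin (m + 1)) fun i => ModBy A (HHodge f (i : ℕ) (m - (i : ℕ))) N) ≃ₗ[A]
          ModBy A (HDR f m) N,
        ∀ (i : Fin (m + 1)) (x : ModBy A (HHodge f (i : ℕ) (m - (i : ℕ))) N),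
          compDR f N m (Φ (DirectSum.lof A (Fin (m + 1))
            (fun i => ModBy A (HHodge f (i : ℕ) (m - (i : ℕ))) N) i x)) =
            ((e (i : ℕ)).symm x : HDRmod f N m) := by
  -- Étale algebras are flat and of finite type: flatness over ℤ makes N regular on A and on forms,
  -- and finite type makes A noetherian, as Krull's theorem requires.
  have : Module.Flat ℤ A := Module.Flat.trans ℤ (MvPolynomial (Fin r) ℤ) A
  have : IsNoetherianRing A := Algebra.FiniteType.isNoetherianRing (MvPolynomial (Fin r) ℤ) A
  exact hodge_decomposition_mod (deRham f) N (mono_nsmul_Omega f hN)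
    (fun b hb => eq_zero_of_nsmul_eq_zero_of_flat hN (by rw [nsmul_eq_mul, hb]))
    (free_HDR f hDR) (free_HHodge f hHodge) (bijective_closedModCohMap f N hZ) m
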